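/- Let $n\ge 2$ be an integer, let $Q_1,Q_2>1$, and put $A=\{x\in\mathbf{R}^n: 1/e<|x|<1\}$. For $p>1$ and $\alpha>1-1/p$ write $Q_{\alpha,p}=\dfrac{\alpha^p}{p\alpha-p+1}$, and let $c_{n-1}$ be the surface area of the unit sphere in $\mathbf{R}^n$. For $Q\geq 1$, a function $u\in W^{1,n}_{\mathrm{loc}}(A)$ is called a $Q$-quasisuperminimizer in $A$ (with $p=n$) if $\int_{\varphi\ne0}|\nabla u|^n\,dx\le Q\int_{\varphi\ne0}|\nabla(u+\varphi)|^n\,dx$ for all nonnegative $\varphi\in W^{1,n}_0(A)$. There are a unique $\alpha_1>1$ with $Q_{\alpha_1,n}=Q_1$ and a unique $\alpha_2\in(1-1/n,1)$ with $Q_{\alpha_2,n}=Q_2$. Let $$u_1(x)=(\log|ex|)^{\alpha_1},\qquad u_2(x)=1-(-\log|x|)^{\alpha_2},\qquad u=\min\{u_1,u_2\}\qquad\text{on } A .$$ There is a unique $r_0\in(1/e,1)$ such that $u_1=u_2$ on $\{|x|=r_0\}$, that is, $(\log er_0)^{\alpha_1}=1-(-\log r_0)^{\alpha_2}$. Put $$\widehat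 Q=Q_1(\log er_0)^{n(\alpha_1-1)+1}+Q_2(-\log r_0)^{n(\alpha_2-1)+1}.$$ Then the following hold. (a) $u\in W^{1,n}(A)$ and $\int_A|\nabla u|^n\,dx=c_{n-1}\widehat Q$. (b) $u$ is not a $Q$-quasisuperminimizer in $A$ for any $Q<\widehat Q$. (c) $\widehat Q=\widetilde Q$, where $\widetilde Q=\widetilde Q(Q_1,Q_2,n)$ is the one-dimensional constant of Björn–Björn–Korte, that is, $\widetilde Q=Q_1x_0^{n(\alpha_1-1)+1}+Q_2(1-x_0)^{n(\alpha_2-1)+1}$ with $x_0\in(0,1)$ the unique solution of $1=(1-x_0)^{\alpha_2}+x_0^{\alpha_1}$. This is the $n$-energy $\int_0^1|w'|^n\,dx$ of the one-dimensional example $w(x)=\min\{x^{\alpha_1},1-(1-x)^{\alpha_2}\}$ on $(0,1)$. -/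

import Mathlib

open MeasureTheory Set Filter Topology
open scoped ENNReal

noncomputable section

/-- The `n`-dimensional Euclidean space `ℝⁿ`. -/
abbrev RSpace (n : ℕ) : Type := EuclideanSpace ℝ (Fin n)

/-- Test functions: `ψ ∈ C_c^∞(Ω)`. -/
def IsTestFunction {n : ℕ} (Ω : Set (RSpace n)) (ψ : RSpace n → ℝ) : Prop :=
  ContDiff ℝ ((⊤ : ℕ∞) : WithTop ℕ∞) ψ ∧ HasCompactSupport ψ ∧ tsupport ψ ⊆ Ω

/-- `g` is the weak (distributional) gradient of `u` in `Ω`: both are locally integrable in `Ω`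
and `∫_Ω u ∂_y ψ = - ∫_Ω ⟨g, y⟩ ψ` for all test functions `ψ` and all directions `y`. -/
def HasWeakGradient {n : ℕ} (Ω : Set (RSpace n)) (u : RSpace n → ℝ)
    (g : RSpace n → RSpace n) : Prop :=
  LocallyIntegrableOn u Ω volume ∧ LocallyIntegrableOn g Ω volume ∧
    ∀ ψ : RSpace n → ℝ, IsTestFunction Ω ψ → ∀ y : RSpace n,
      ∫ x in Ω, u x * fderiv ℝ ψ x y = - ∫ x in Ω, inner ℝ (g x) y * ψ x

/-- The Sobolev space `W^{1,p}(Ω)`. -/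
def MemW1p {n : ℕ} (Ω : Set (RSpace n)) (p : ℝ) (u : RSpace n → ℝ) : Prop :=
  MemLp u (ENNReal.ofReal p) (volume.restrict Ω) ∧
    ∃ g : RSpace n → RSpace n, HasWeakGradient Ω u g ∧
      MemLp g (ENNReal.ofReal p) (volume.restrict Ω)

/-- The local Sobolev space `W^{1,p}_loc(Ω)`. -/
def MemW1pLoc {n : ℕ} (Ω : Set (RSpace n)) (p : ℝ) (u : RSpace n → ℝ) : Prop :=
  ∃ g : RSpace n → RSpace n, HasWeakGradient Ω u g ∧
    ∀ K : Set (RSpace n), IsCompact K → K ⊆ Ω →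
      MemLp u (ENNReal.ofReal p) (volume.restrict K) ∧
      MemLp g (ENNReal.ofReal p) (volume.restrict K)

/-- The Sobolev space `W^{1,p}_0(Ω)` with zero boundary values: the closure of `C_c^∞(Ω)`
in `W^{1,p}(Ω)`. -/
def MemW1pZero {n : ℕ} (Ω : Set (RSpace n)) (p : ℝ) (φ : RSpace n → ℝ) : Prop :=
  MemLp φ (ENNReal.ofReal p) (volume.restrict Ω) ∧
    ∃ h : RSpace n → RSpace n, HasWeakGradient Ω φ h ∧
      MemLp h (ENNReal.ofReal p) (volume.restrict Ω) ∧
      ∃ ψ : ℕ → RSpace n → ℝ, (∀ k, IsTestFunction Ω (ψ k)) ∧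
        Tendsto (fun k => eLpNorm (fun x => φ x - ψ k x) (ENNReal.ofReal p)
          (volume.restrict Ω)) atTop (𝓝 0) ∧
        Tendsto (fun k => eLpNorm (fun x => h x - gradient (ψ k) x) (ENNReal.ofReal p)
          (volume.restrict Ω)) atTop (𝓝 0)

/-- The energy `∫_S |g|^p dx`, with values in `[0, ∞]`, of a gradient field `g`. -/
def pEnergy {n : ℕ} (S : Set (RSpace n)) (p : ℝ) (g : RSpace n → RSpace n) : ℝ≥0∞ :=
  ∫⁻ x in S, ‖g x‖ₑ ^ p

/-- `u` is a `Q`-quasisuperminimizer in `Ω`: `u ∈ W^{1,p}_loc(Ω)` and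
`∫_{φ ≠ 0} |∇u|^p ≤ Q ∫_{φ ≠ 0} |∇(u + φ)|^p` for all nonnegative `φ ∈ W^{1,p}_0(Ω)`.
(Weak gradients are unique up to null sets, so it does not matter which ones are used.) -/
def IsQuasisuperminimizer {n : ℕ} (Ω : Set (RSpace n)) (p Q : ℝ) (u : RSpace n → ℝ) : Prop :=
  MemW1pLoc Ω p u ∧
    ∀ (φ : RSpace n → ℝ) (g h : RSpace n → RSpace n),
      HasWeakGradient Ω u g → MemW1pZero Ω p φ → HasWeakGradient Ω φ h →
      (∀ᵐ x ∂(volume.restrict Ω), 0 ≤ φ x) →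
      pEnergy (Ω ∩ {x | φ x ≠ 0}) p g ≤
        ENNReal.ofReal Q * pEnergy (Ω ∩ {x | φ x ≠ 0}) p (fun x => g x + h x)

/-- The annulus `A = {x ∈ ℝⁿ : 1/e < |x| < 1}`. -/
def annulusA (n : ℕ) : Set (RSpace n) := {x | (Real.exp 1)⁻¹ < ‖x‖ ∧ ‖x‖ < 1}

/-- `c_{n-1}`, the surface area of the unit sphere `S^{n-1}` in `ℝⁿ`. -/
def sphereArea (n : ℕ) : ℝ :=
  ((volume : Measure (RSpace n)).toSphere).real Set.univ

/-- `Q_{α,p} = α^p / (pα - p + 1)`. -/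
def QConst (p α : ℝ) : ℝ := α ^ p / (p * α - p + 1)

/-- `α > 1` and `Q_{α,p} = Q`. -/
def IsUpperExponent (p Q α : ℝ) : Prop := 1 < α ∧ QConst p α = Q

/-- `1 - 1/p < α < 1` and `Q_{α,p} = Q`. -/
def IsLowerExponent (p Q α : ℝ) : Prop := 1 - 1 / p < α ∧ α < 1 ∧ QConst p α = Q

/-- The radial profile `r ↦ log^α (er)`. -/
def logPow₁ (α r : ℝ) : ℝ := (Real.log (Real.exp 1 * r)) ^ α

/-- The radial profile `r ↦ 1 - (-log r)^α`. -/
def logPow₂ (α r : ℝ) : ℝ := 1 - (-Real.log r) ^ α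

/-- `r ∈ (1/e, 1)` is a crossing point of the two profiles. -/
def IsCrossing (α₁ α₂ r : ℝ) : Prop :=
  r ∈ Ioo (Real.exp 1)⁻¹ 1 ∧ logPow₁ α₁ r = logPow₂ α₂ r

/-- `u = min {u₁, u₂}` with `u₁(x) = log^{α₁} |ex|` and `u₂(x) = 1 - (-log |x|)^{α₂}`. -/
def minLogPow (n : ℕ) (α₁ α₂ : ℝ) (x : RSpace n) : ℝ :=
  min (logPow₁ α₁ ‖x‖) (logPow₂ α₂ ‖x‖)

/-- `Q̂ = Q₁ (log er₀)^{n(α₁-1)+1} + Q₂ (-log r₀)^{n(α₂-1)+1}`. -/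
def QHat (n : ℕ) (Q₁ Q₂ α₁ α₂ r₀ : ℝ) : ℝ :=
  Q₁ * (Real.log (Real.exp 1 * r₀)) ^ ((n : ℝ) * (α₁ - 1) + 1) +
    Q₂ * (-Real.log r₀) ^ ((n : ℝ) * (α₂ - 1) + 1)

/-- `x ∈ (0, 1)` is a solution of `1 = (1 - x)^{α₂} + x^{α₁}`. -/
def IsCrossingOne (α₁ α₂ x : ℝ) : Prop :=
  x ∈ Ioo (0 : ℝ) 1 ∧ 1 = (1 - x) ^ α₂ + x ^ α₁

/-- `c` is the one-dimensional constant `Q̃(Q₁, Q₂, p)`: with the exponents `α₁ > 1 > α₂` given by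
`Q₁`, `Q₂` and `p`, and with the solution `x₀ ∈ (0,1)` of `1 = (1 - x₀)^{α₂} + x₀^{α₁}`,
`c = Q₁ x₀^{p(α₁-1)+1} + Q₂ (1 - x₀)^{p(α₂-1)+1}`. -/
def IsQTilde (p Q₁ Q₂ c : ℝ) : Prop :=
  ∃ α₁ α₂ x₀ : ℝ, IsUpperExponent p Q₁ α₁ ∧ IsLowerExponent p Q₂ α₂ ∧
    IsCrossingOne α₁ α₂ x₀ ∧
    c = Q₁ * x₀ ^ (p * (α₁ - 1) + 1) + Q₂ * (1 - x₀) ^ (p * (α₂ - 1) + 1)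

/-- The one-dimensional example `x ↦ min {x^{α₁}, 1 - (1 - x)^{α₂}}` on `(0,1)`. -/
def minPow (α₁ α₂ x : ℝ) : ℝ := min (x ^ α₁) (1 - (1 - x) ^ α₂)

end

/-! Put s = 1 + log|x|, which maps the annulus onto (0,1). A radial function Φ(s) has gradient of
length |Φ'(s)|/|x|. Since the exponent p equals the dimension n, its energy density is |Φ'(s)|^n
|x|^{-n}, and |x|^{-n} dx pushes forward to c_{n-1} ds. So the n-energy on the annulus is c_{n-1}
times the one-dimensional energy of the profile (`lintegral_annulusA`, `pEnergy_radialGrad`). In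
this variable u becomes w(s) = min{s^{α₁}, 1-(1-s)^{α₂}}, the crossing radius becomes x₀ = 1 + log
r₀, and integrating powers on either side of x₀ (`lintegral_minPowDeriv`) gives (a) and (c).

For (b), compare u with log|ex|, whose profile is s and whose energy is c_{n-1}. Since α₁ > 1, w(s)
< s on (0,1), so φ = s - w(s) is positive on all of A. It vanishes at both ends, and u + φ =
log|ex|, so the quasisuperminimizing inequality would read c_{n-1} Q̂ ≤ Q c_{n-1}.

The analytic work is to show that the pointwise gradient of a radial profile is its weak gradient
(`hasWeakGradient_radial`) and that φ is a limit of test functions (`memW1pZero_radial`). Uniqueness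
of the crossing point comes from Rolle's theorem (`isCrossingOne_unique`). -/

/-! ### Polar and logarithmic coordinates on the annulus. -/

/-- Polar coordinates for nonnegative radial functions. -/
theorem lintegral_fun_norm {n : ℕ} (hn : n ≠ 0) {f : ℝ → ℝ≥0∞} (hf : Measurable f) :
    ∫⁻ x : RSpace n, f ‖x‖ =
      ENNReal.ofReal (sphereArea n) * ∫⁻ r in Ioi (0 : ℝ), ENNReal.ofReal (r ^ (n - 1)) * f r := by
  have : Nonempty (Fin n) := ⟨⟨0, Nat.pos_of_ne_zero hn⟩⟩
  have hmp := (volume : Measure (RSpace n)).measurePreserving_homeomorphUnitSphereProd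
  have h1 : ∫⁻ x : RSpace n, f ‖x‖ =
      ∫⁻ x : ({(0 : RSpace n)}ᶜ : Set (RSpace n)), f ‖x.1‖ ∂(volume.comap Subtype.val) := by
    rw [lintegral_subtype_comap (measurableSet_singleton _).compl (fun x ↦ f ‖x‖),
      restrict_compl_singleton]
  have h2 := hmp.lintegral_comp_emb (Homeomorph.measurableEmbedding _)
    (f ∘ Subtype.val ∘ Prod.snd)
  simp only [Function.comp_def, homeomorphUnitSphereProd_apply_snd_coe] at h2
  have hm : Measurable fun r : Ioi (0 : ℝ) ↦ f r := hf.comp measurable_subtype_coe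
  rw [h1, h2, lintegral_prod (fun b : Metric.sphere (0 : RSpace n) 1 × Ioi (0 : ℝ) ↦ f b.2)
    (hm.comp measurable_snd).aemeasurable]
  simp only [lintegral_const]
  rw [mul_comm]
  congr 1
  · rw [sphereArea, ofReal_measureReal]
  · rw [finrank_euclideanSpace, Fintype.card_fin, Measure.volumeIoiPow,
      lintegral_withDensity_eq_lintegral_mul _ (by fun_prop) hm,
      ← lintegral_subtype_comap measurableSet_Ioi]
    rfl

/-- The radius in logarithmic coordinates, normalized to range over `(0, 1)` on the annulus. -/
noncomputable def logRadius {n : ℕ} (x : RSpace n) : ℝ := 1 + Real.log ‖x‖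

theorem measurable_logRadius {n : ℕ} : Measurable (logRadius : RSpace n → ℝ) := by
  unfold logRadius; fun_prop

theorem mem_annulusA_pos {n : ℕ} {x : RSpace n} (hx : x ∈ annulusA n) : 0 < ‖x‖ :=
  (inv_pos.2 (Real.exp_pos 1)).trans hx.1

theorem logRadius_mem {n : ℕ} {x : RSpace n} (hx : x ∈ annulusA n) :
    logRadius x ∈ Ioo (0 : ℝ) 1 := by
  have h := mem_annulusA_pos hx
  have h1 := Real.log_lt_log (inv_pos.2 (Real.exp_pos 1)) hx.1
  rw [Real.log_inv, Real.log_exp] at h1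
  have h2 := Real.log_neg h hx.2
  constructor <;> simp only [logRadius] <;> linarith

theorem isOpen_annulusA (n : ℕ) : IsOpen (annulusA n) :=
  (isOpen_lt continuous_const continuous_norm).inter (isOpen_lt continuous_norm continuous_const)

theorem volume_annulusA_lt_top (n : ℕ) : volume (annulusA n) < ∞ := by
  refine (measure_mono fun x hx ↦ ?_).trans_lt (measure_ball_lt_top (x := (0 : RSpace n)) (r := 1))
  simpa using hx.2

theorem image_exp_Ioo : (fun s : ℝ ↦ Real.exp (s - 1)) '' Ioo 0 1 = Ioo (Real.exp 1)⁻¹ 1 := by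
  ext r
  constructor
  · rintro ⟨s, hs, rfl⟩
    rw [← Real.exp_neg]
    refine ⟨Real.exp_lt_exp.2 (by linarith [hs.1]), ?_⟩
    rw [Real.exp_lt_one_iff]
    linarith [hs.2]
  · intro hr
    have h0 : 0 < r := (inv_pos.2 (Real.exp_pos 1)).trans hr.1
    have h1 := Real.log_lt_log (inv_pos.2 (Real.exp_pos 1)) hr.1
    rw [Real.log_inv, Real.log_exp] at h1
    exact ⟨1 + Real.log r, ⟨by linarith, by linarith [Real.log_neg h0 hr.2]⟩,
      by simp [Real.exp_log h0]⟩

/-- In logarithmic coordinates the measure `|x|⁻ⁿ dx` on the annulus is `c_{n-1} ds`. -/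
theorem lintegral_annulusA {n : ℕ} (hn : n ≠ 0) {F : ℝ → ℝ≥0∞} (hF : Measurable F) :
    ∫⁻ x in annulusA n, F (logRadius x) * ENNReal.ofReal ((‖x‖ ^ n)⁻¹) =
      ENNReal.ofReal (sphereArea n) * ∫⁻ s in Ioo (0 : ℝ) 1, F s := by
  set G : ℝ → ℝ≥0∞ := (Ioo (Real.exp 1)⁻¹ 1).indicator
    fun r ↦ F (1 + Real.log r) * ENNReal.ofReal ((r ^ n)⁻¹) with hG
  have hGm : Measurable G := by
    refine Measurable.indicator ?_ measurableSet_Ioo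
    exact (hF.comp (by fun_prop)).mul (by fun_prop)
  have h1 : ∫⁻ x in annulusA n, F (logRadius x) * ENNReal.ofReal ((‖x‖ ^ n)⁻¹) =
      ∫⁻ x : RSpace n, G ‖x‖ := by
    rw [← lintegral_indicator (isOpen_annulusA n).measurableSet]
    rfl
  rw [h1, lintegral_fun_norm hn hGm]
  congr 1
  -- The polar density r^{n-1} times r^{-n} leaves dr/r, which the substitution r = e^{s-1} turns
  -- into ds.
  have h2 : ∀ r ∈ Ioi (0 : ℝ), ENNReal.ofReal (r ^ (n - 1)) * G r =
      (Ioo (Real.exp 1)⁻¹ 1).indicator (fun r ↦ ENNReal.ofReal r⁻¹ * F (1 + Real.log r)) r := by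
    intro r (hr : 0 < r)
    by_cases h : r ∈ Ioo (Real.exp 1)⁻¹ 1
    · rw [hG, indicator_of_mem h, indicator_of_mem h, mul_comm (F _), ← mul_assoc,
        ← ENNReal.ofReal_mul (by positivity)]
      congr 2
      obtain ⟨m, rfl⟩ := Nat.exists_eq_succ_of_ne_zero hn
      simp only [Nat.succ_eq_add_one, Nat.add_sub_cancel]
      field_simp
      exact (pow_succ r m).symm
    · rw [hG, indicator_of_notMem h, indicator_of_notMem h, mul_zero]
  rw [setLIntegral_congr_fun measurableSet_Ioi h2, lintegral_indicator measurableSet_Ioo,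
    Measure.restrict_restrict measurableSet_Ioo, inter_eq_self_of_subset_left
      (show Ioo (Real.exp 1)⁻¹ 1 ⊆ Ioi 0 from
        fun r hr ↦ (inv_pos.2 (Real.exp_pos 1)).trans hr.1), ← image_exp_Ioo,
    lintegral_image_eq_lintegral_abs_deriv_mul (f := fun s ↦ Real.exp (s - 1))
      (f' := fun s ↦ Real.exp (s - 1)) measurableSet_Ioo]
  · refine setLIntegral_congr_fun measurableSet_Ioo fun s _ ↦ ?_
    simp only [Real.log_exp, abs_of_pos (Real.exp_pos _), add_sub_cancel]
    rw [← mul_assoc, ← ENNReal.ofReal_mul (Real.exp_pos _).le, mul_inv_cancel₀ (Real.exp_ne_zero _)]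
    simp
  · intro s _
    simpa using ((hasDerivAt_id s).sub_const 1).exp.hasDerivWithinAt
  · intro s _ t _ h
    simpa using h

/-- The gradient of `x ↦ Φ (1 + log |x|)` when `Φ' = D`. -/
noncomputable def radialGrad {n : ℕ} (D : ℝ → ℝ) (x : RSpace n) : RSpace n :=
  (D (logRadius x) / ‖x‖ ^ 2) • x

theorem measurable_radialGrad {n : ℕ} {D : ℝ → ℝ} (hD : Measurable D) :
    Measurable (radialGrad D : RSpace n → RSpace n) :=
  ((hD.comp measurable_logRadius).div (by fun_prop)).smul measurable_id

theorem enorm_radialGrad_pow {n : ℕ} (D : ℝ → ℝ) {x : RSpace n} (hx : x ≠ 0) :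
    ‖radialGrad D x‖ₑ ^ (n : ℝ) =
      ‖D (logRadius x)‖ₑ ^ (n : ℝ) * ENNReal.ofReal ((‖x‖ ^ n)⁻¹) := by
  have h : 0 < ‖x‖ := norm_pos_iff.2 hx
  have : ‖radialGrad D x‖ = ‖D (logRadius x)‖ * ‖x‖⁻¹ := by
    rw [radialGrad, norm_smul, norm_div, norm_pow, norm_norm]
    field_simp
  rw [← ofReal_norm, this, ENNReal.ofReal_mul (norm_nonneg _), ofReal_norm,
    ENNReal.mul_rpow_of_nonneg _ _ (Nat.cast_nonneg n)]
  congr 1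
  rw [ENNReal.rpow_natCast, ← ENNReal.ofReal_pow (by positivity), inv_pow]

theorem pEnergy_radialGrad {n : ℕ} (hn : n ≠ 0) {D : ℝ → ℝ} (hD : Measurable D) :
    pEnergy (annulusA n) n (radialGrad D) =
      ENNReal.ofReal (sphereArea n) * ∫⁻ s in Ioo (0 : ℝ) 1, ‖D s‖ₑ ^ (n : ℝ) := by
  rw [← lintegral_annulusA hn (hD.enorm.pow_const _), pEnergy]
  refine setLIntegral_congr_fun (isOpen_annulusA n).measurableSet fun x hx ↦ ?_
  exact enorm_radialGrad_pow D (norm_pos_iff.1 (mem_annulusA_pos hx))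

theorem eLpNorm_radialGrad {n : ℕ} (hn : n ≠ 0) {D : ℝ → ℝ} (hD : Measurable D) :
    eLpNorm (radialGrad D) (ENNReal.ofReal n) (volume.restrict (annulusA n)) =
      ENNReal.ofReal (sphereArea n) ^ (1 / (n : ℝ)) *
        eLpNorm D (ENNReal.ofReal n) (volume.restrict (Ioo 0 1)) := by
  have h0 : ENNReal.ofReal (n : ℝ) ≠ 0 := by simpa using hn
  have ht : (ENNReal.ofReal (n : ℝ)).toReal = n := by simp
  rw [eLpNorm_eq_lintegral_rpow_enorm_toReal h0 ENNReal.ofReal_ne_top,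
    eLpNorm_eq_lintegral_rpow_enorm_toReal h0 ENNReal.ofReal_ne_top, ht,
    ← ENNReal.mul_rpow_of_nonneg _ _ (by positivity), ← pEnergy_radialGrad hn hD, pEnergy]

theorem sphereArea_pos {n : ℕ} (hn : n ≠ 0) : 0 < sphereArea n := by
  have : Nonempty (Fin n) := ⟨⟨0, Nat.pos_of_ne_zero hn⟩⟩
  rw [sphereArea, measureReal_def]
  refine ENNReal.toReal_pos ?_ (measure_ne_top _ _)
  rw [Measure.measure_univ_ne_zero]
  exact Measure.toSphere_ne_zero _

/-! ### Existence and uniqueness of the exponents. -/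

theorem continuousOn_QConst {p : ℝ} (hp : 0 < p) : ContinuousOn (QConst p) (Ioi (1 - 1 / p)) := by
  intro α hα
  have h1 : 0 < p * α - p + 1 := by
    have := mul_lt_mul_of_pos_left (mem_Ioi.1 hα) hp
    rw [mul_sub, mul_one_div_cancel hp.ne'] at this
    linarith
  refine ContinuousAt.continuousWithinAt ?_
  unfold QConst
  refine ContinuousAt.div ?_ (by fun_prop) h1.ne'
  exact Real.continuousAt_rpow_const _ _ (Or.inr hp.le)

/-- For p > 1 the derivative of log Q_{α,p} has the sign of α - 1, so Q_{α,p} decreases to its value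
1 at α = 1 and increases afterwards. -/
theorem hasDerivAt_log_QConst {p α : ℝ} (hα : 0 < α) (h : 0 < p * α - p + 1) :
    HasDerivAt (fun α ↦ p * Real.log α - Real.log (p * α - p + 1))
      (p * (p - 1) * (α - 1) / (α * (p * α - p + 1))) α := by
  have h1 := (Real.hasDerivAt_log hα.ne').const_mul p
  have h2 := ((((hasDerivAt_id α).const_mul p).sub_const p).add_const 1).log h.ne'
  refine (h1.sub h2).congr_deriv ?_
  have h3 := h.ne'
  simp only [id]
  rw [mul_one, eq_div_iff (by positivity), sub_mul, div_mul_eq_mul_div,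
    ← mul_assoc, ← mul_assoc, inv_mul_cancel_right₀ hα.ne', mul_div_cancel_right₀ _ h3]
  ring

theorem log_QConst {p α : ℝ} (hα : 0 < α) (h : 0 < p * α - p + 1) :
    Real.log (QConst p α) = p * Real.log α - Real.log (p * α - p + 1) := by
  rw [QConst, Real.log_div (Real.rpow_pos_of_pos hα _).ne' h.ne', Real.log_rpow hα]

theorem existsUnique_isUpperExponent {p Q : ℝ} (hp : 2 ≤ p) (hQ : 1 < Q) :
    ∃! α, IsUpperExponent p Q α := by
  have hpos : ∀ α, 1 ≤ α → 0 < p * α - p + 1 := fun α h ↦ by nlinarith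
  have hsub : ∀ a, Icc 1 a ⊆ Ioi (1 - 1 / p) := fun a x hx ↦ by
    have : 0 < 1 / p := by positivity
    exact mem_Ioi.2 (by linarith [hx.1])
  have hmono : StrictMonoOn (fun α ↦ p * Real.log α - Real.log (p * α - p + 1)) (Ici 1) := by
    refine strictMonoOn_of_deriv_pos (convex_Ici 1) (fun α hα ↦ ?_) fun α hα ↦ ?_
    · have hα' : 1 ≤ α := hα
      exact (hasDerivAt_log_QConst (by linarith) (hpos α hα)).continuousAt.continuousWithinAt
    · rw [interior_Ici] at hα
      have hα' : 1 < α := hα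
      have h1 := hpos α hα'.le
      rw [(hasDerivAt_log_QConst (by linarith) h1).deriv]
      have : 0 < α - 1 := by linarith
      have : 0 < p - 1 := by linarith
      positivity
  have hv1 : QConst p 1 = 1 := by simp [QConst]
  have hpQ : 1 ≤ p * Q := by nlinarith
  -- The right endpoint pQ works because (pQ)^p ≥ (pQ)² ≥ Q(p·pQ - p + 1), using p ≥ 2.
  have hv2 : Q ≤ QConst p (p * Q) := by
    rw [QConst, le_div_iff₀ (hpos _ hpQ)]
    have h2 : (p * Q) ^ (2 : ℝ) ≤ (p * Q) ^ p := Real.rpow_le_rpow_of_exponent_le hpQ hp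
    rw [Real.rpow_two] at h2
    nlinarith
  obtain ⟨α, hα, he⟩ := intermediate_value_Icc hpQ
    ((continuousOn_QConst (by linarith : 0 < p)).mono (hsub _)) ⟨hv1.le.trans hQ.le, hv2⟩
  have h1 : 1 < α := hα.1.lt_of_ne (by rintro rfl; linarith)
  refine ⟨α, ⟨h1, he⟩, fun β hβ ↦ hmono.injOn (mem_Ici.2 hβ.1.le) (mem_Ici.2 h1.le) ?_⟩
  have := hβ.1
  rw [← log_QConst (by linarith) (hpos _ hβ.1.le), ← log_QConst (by linarith) (hpos _ h1.le),
    hβ.2, he]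

theorem existsUnique_isLowerExponent {p Q : ℝ} (hp : 2 ≤ p) (hQ : 1 < Q) :
    ∃! α, IsLowerExponent p Q α := by
  have hp0 : 0 < p := by linarith
  have hip : 1 / p < 1 := by rw [div_lt_one hp0]; linarith
  have hpos : ∀ α, 1 - 1 / p < α → 0 < p * α - p + 1 := fun α h ↦ by
    have := mul_lt_mul_of_pos_left h hp0
    rw [mul_sub, mul_one_div_cancel hp0.ne'] at this
    linarith
  have hmono : StrictAntiOn (fun α ↦ p * Real.log α - Real.log (p * α - p + 1))
      (Ioc (1 - 1 / p) 1) := by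
    refine strictAntiOn_of_deriv_neg (convex_Ioc _ _) (fun α hα ↦ ?_) fun α hα ↦ ?_
    · exact (hasDerivAt_log_QConst (by linarith [hα.1])
        (hpos α hα.1)).continuousAt.continuousWithinAt
    · rw [interior_Ioc] at hα
      have h1 := hpos α hα.1
      have h0 : 0 < α := by linarith [hα.1]
      rw [(hasDerivAt_log_QConst h0 h1).deriv]
      have : 0 < p - 1 := by linarith
      exact div_neg_of_neg_of_pos (mul_neg_of_pos_of_neg (by positivity) (by linarith [hα.2]))
        (by positivity)
  have hv1 : QConst p 1 = 1 := by simp [QConst]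
  set κ : ℝ := (1 - 1 / p) ^ p with hκ
  have hκ0 : 0 < κ := Real.rpow_pos_of_pos (by linarith) _
  have hκ1 : κ ≤ 1 := Real.rpow_le_one (by linarith) (by linarith [one_div_pos.2 hp0]) hp0.le
  -- Q_{α,p} blows up as α decreases to 1 - 1/p. At α = 1 - 1/p + η the denominator is pη = κ/Q,
  -- while the numerator is at least κ.
  set η : ℝ := κ / (p * Q) with hη
  have hη0 : 0 < η := by positivity
  have hη1 : η < 1 / p := by
    rw [hη, div_lt_div_iff₀ (by positivity) hp0]
    nlinarith
  have hv2 : Q ≤ QConst p (1 - 1 / p + η) := by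
    have hd : p * (1 - 1 / p + η) - p + 1 = p * η := by field_simp; ring
    rw [QConst, hd, le_div_iff₀ (by positivity)]
    have : Q * (p * η) = κ := by rw [hη]; field_simp
    rw [this]
    exact Real.rpow_le_rpow (by linarith) (by linarith) hp0.le
  obtain ⟨α, hα, he⟩ := intermediate_value_Icc' (by linarith : 1 - 1 / p + η ≤ 1)
    ((continuousOn_QConst hp0).mono fun x hx ↦ mem_Ioi.2 (by linarith [hx.1]))
    ⟨hv1.le.trans hQ.le, hv2⟩
  have h1 : α < 1 := hα.2.lt_of_ne (by rintro rfl; linarith)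
  have h2 : 1 - 1 / p < α := by linarith [hα.1]
  refine ⟨α, ⟨h2, h1, he⟩, fun β hβ ↦ hmono.injOn ⟨hβ.1, hβ.2.1.le⟩ ⟨h2, h1.le⟩ ?_⟩
  have := hβ.1
  rw [← log_QConst (by linarith) (hpos _ hβ.1), ← log_QConst (by linarith) (hpos _ h2),
    hβ.2.2, he]

/-! ### The crossing point of s^a and 1 - (1-s)^b. -/

theorem continuous_rpow_add_rpow {a b : ℝ} (ha : 0 ≤ a) (hb : 0 ≤ b) :
    Continuous fun s : ℝ ↦ (1 - s) ^ b + s ^ a :=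
  ((Real.continuous_rpow_const hb).comp (by fun_prop)).add (Real.continuous_rpow_const ha)

theorem hasDerivAt_one_sub_rpow {b s : ℝ} (hs : s < 1) :
    HasDerivAt (fun s : ℝ ↦ (1 - s) ^ b) (-(b * (1 - s) ^ (b - 1))) s := by
  refine (((hasDerivAt_id s).const_sub 1).rpow_const (p := b)
    (Or.inl (by simp only [id]; linarith))).congr_deriv ?_
  simp

theorem eventually_rpow_lt {d c : ℝ} (hd : 0 < d) (hc : 0 < c) :
    ∀ᶠ s : ℝ in 𝓝[>] 0, s ^ d < c := by
  have : Tendsto (fun s : ℝ ↦ s ^ d) (𝓝 0) (𝓝 0) := by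
    simpa [Real.zero_rpow hd.ne'] using (Real.continuousAt_rpow_const 0 d (Or.inr hd.le)).tendsto
  exact (this.mono_left nhdsWithin_le_nhds).eventually_lt_const hc

/-- `(1 - s)^b + s^a < 1` for small `s > 0`. -/
theorem eventually_rpow_add_rpow_lt_one {a b : ℝ} (ha : 1 < a) (hb : 0 < b) (hb1 : b < 1) :
    ∀ᶠ s : ℝ in 𝓝[>] 0, (1 - s) ^ b + s ^ a < 1 := by
  filter_upwards [eventually_rpow_lt (sub_pos.2 ha) hb, self_mem_nhdsWithin,
    Ioo_mem_nhdsGT (zero_lt_one' ℝ)] with s h1 (h2 : 0 < s) h3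
  -- Bernoulli gives (1-s)^b ≤ 1 - bs, and s^a = s^{a-1} s < bs.
  have h4 := rpow_one_add_le_one_add_mul_self (s := -s) (by linarith [h3.2]) hb.le hb1.le
  have h5 : s ^ a = s ^ (a - 1) * s := by
    rw [← Real.rpow_add_one h2.ne', sub_add_cancel]
  rw [← sub_eq_add_neg] at h4
  nlinarith

/-- `(1 - s)^b + s^a > 1` for `s < 1` close to `1`, in terms of `t = 1 - s`. -/
theorem eventually_one_lt_rpow_add_rpow {a b : ℝ} (ha : 1 < a) (hb1 : b < 1) :
    ∀ᶠ t : ℝ in 𝓝[>] 0, 1 < t ^ b + (1 - t) ^ a := by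
  filter_upwards [eventually_rpow_lt (sub_pos.2 hb1) (inv_pos.2 (zero_lt_one.trans ha)),
    self_mem_nhdsWithin, Ioo_mem_nhdsGT (zero_lt_one' ℝ)] with t h1 (h2 : 0 < t) h3
  -- Bernoulli gives (1-t)^a ≥ 1 - at, and at < t^b because t^{1-b} < 1/a.
  have h4 := one_add_mul_self_le_rpow_one_add (s := -t) (by linarith [h3.2]) ha.le
  have h5 : t ^ (1 - b) * t ^ b = t := by
    rw [← Real.rpow_add h2, sub_add_cancel, Real.rpow_one]
  have h6 : 0 < t ^ b := Real.rpow_pos_of_pos h2 _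
  rw [← sub_eq_add_neg] at h4
  have h7 : a * t < t ^ b := by
    calc a * t = a * t ^ (1 - b) * t ^ b := by rw [mul_assoc, h5]
      _ < 1 * t ^ b := by
        gcongr
        rwa [mul_comm, ← lt_div_iff₀ (zero_lt_one.trans ha), one_div]
      _ = t ^ b := one_mul _
  linarith

/-- The logarithmic derivative quotient `(a-1) log s + (1-b) log (1-s)` takes no value three
times. -/
theorem not_three_eq {a b x y z : ℝ} (ha : 1 < a) (hb1 : b < 1) (hx : 0 < x) (hxy : x < y)
    (hyz : y < z) (hz : z < 1)
    (h1 : (a - 1) * Real.log x + (1 - b) * Real.log (1 - x) =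
      (a - 1) * Real.log y + (1 - b) * Real.log (1 - y))
    (h2 : (a - 1) * Real.log y + (1 - b) * Real.log (1 - y) =
      (a - 1) * Real.log z + (1 - b) * Real.log (1 - z)) : False := by
  set g : ℝ → ℝ := fun s ↦ (a - 1) * Real.log s + (1 - b) * Real.log (1 - s)
  have hd : ∀ s, 0 < s → s < 1 → HasDerivAt g ((a - 1) * s⁻¹ + (1 - b) * (-1 / (1 - s))) s := by
    intro s h0 hs
    exact ((Real.hasDerivAt_log h0.ne').const_mul (a - 1)).add
      ((((hasDerivAt_id s).const_sub 1).log (by simp only [id]; linarith)).const_mul (1 - b))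
  have hc : ∀ u v, 0 < u → v < 1 → ContinuousOn g (Icc u v) := fun u v hu hv s hs ↦
    (hd s (hu.trans_le hs.1) (hs.2.trans_lt hv)).continuousAt.continuousWithinAt
  obtain ⟨c, hc1, hc2⟩ := exists_hasDerivAt_eq_zero hxy (hc x y hx (hyz.trans hz)) h1
    fun s hs ↦ hd s (hx.trans hs.1) (hs.2.trans (hyz.trans hz))
  obtain ⟨d, hd1, hd2⟩ := exists_hasDerivAt_eq_zero hyz (hc y z (hx.trans hxy) hz) h2
    fun s hs ↦ hd s ((hx.trans hxy).trans hs.1) (hs.2.trans hz)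
  -- Rolle has produced two distinct zeros of g', but g' vanishes only at s = (a-1)/(a-b).
  have key : ∀ s, 0 < s → s < 1 → (a - 1) * s⁻¹ + (1 - b) * (-1 / (1 - s)) = 0 →
      a - 1 = (a - b) * s := by
    intro s h0 hs h
    have : 1 - s ≠ 0 := by linarith
    field_simp at h
    linarith
  have e1 := key c (hx.trans hc1.1) (hc1.2.trans (hyz.trans hz)) hc2
  have e2 := key d ((hx.trans hxy).trans hd1.1) (hd1.2.trans hz) hd2
  have : c < d := hc1.2.trans hd1.1
  nlinarith

/-- The function (1-s)^b + s^a also equals 1 at s = 0 and s = 1, so two interior crossings would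
give four points on the level 1 and, by Rolle, three critical points. Taking logarithms of the
critical point equation contradicts `not_three_eq`. -/
theorem isCrossingOne_unique {a b x y : ℝ} (ha : 1 < a) (hb : 0 < b) (hb1 : b < 1)
    (hx : IsCrossingOne a b x) (hy : IsCrossingOne a b y) : x = y := by
  wlog hxy : x < y generalizing x y
  · rcases lt_trichotomy x y with h | h | h
    · exact absurd h hxy
    · exact h
    · exact (this hy hx h).symm
  exfalso
  obtain ⟨⟨hx0, hx1⟩, hx⟩ := hx
  obtain ⟨⟨hy0, hy1⟩, hy⟩ := hy
  set f : ℝ → ℝ := fun s ↦ (1 - s) ^ b + s ^ a with hf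
  have hcont : Continuous f := continuous_rpow_add_rpow (by linarith) hb.le
  have hd : ∀ s, 0 < s → s < 1 →
      HasDerivAt f (-(b * (1 - s) ^ (b - 1)) + a * s ^ (a - 1)) s := fun s h0 h1 ↦
    (hasDerivAt_one_sub_rpow h1).add (Real.hasDerivAt_rpow_const (Or.inl h0.ne'))
  have hf0 : f 0 = 1 := by simp [hf, Real.zero_rpow (by linarith : a ≠ 0)]
  have hf1 : f 1 = 1 := by simp [hf, Real.zero_rpow hb.ne']
  obtain ⟨c1, h1, h1'⟩ := exists_hasDerivAt_eq_zero hx0 hcont.continuousOn (hf0.trans hx)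
    fun s hs ↦ hd s hs.1 (hs.2.trans hx1)
  obtain ⟨c2, h2, h2'⟩ := exists_hasDerivAt_eq_zero hxy hcont.continuousOn (hx.symm.trans hy)
    fun s hs ↦ hd s (hx0.trans hs.1) (hs.2.trans hy1)
  obtain ⟨c3, h3, h3'⟩ := exists_hasDerivAt_eq_zero hy1 hcont.continuousOn (hy.symm.trans hf1.symm)
    fun s hs ↦ hd s (hy0.trans hs.1) hs.2
  have key : ∀ s, 0 < s → s < 1 → -(b * (1 - s) ^ (b - 1)) + a * s ^ (a - 1) = 0 →
      (a - 1) * Real.log s + (1 - b) * Real.log (1 - s) = Real.log b - Real.log a := by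
    intro s h0 h1 h
    have e : a * s ^ (a - 1) = b * (1 - s) ^ (b - 1) := by linarith
    have h1' : 0 < 1 - s := by linarith
    have := congrArg Real.log e
    rw [Real.log_mul (by linarith) (Real.rpow_pos_of_pos h0 _).ne', Real.log_rpow h0,
      Real.log_mul hb.ne' (Real.rpow_pos_of_pos h1' _).ne', Real.log_rpow h1'] at this
    linarith
  have k1 := key c1 h1.1 (h1.2.trans hx1) h1'
  have k2 := key c2 (hx0.trans h2.1) (h2.2.trans hy1) h2'
  have k3 := key c3 (hy0.trans h3.1) h3.2 h3'
  exact not_three_eq ha hb1 h1.1 (h1.2.trans h2.1) (h2.2.trans h3.1) h3.2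
    (k1.trans k2.symm) (k2.trans k3.symm)

theorem exists_small_lt_one {a b s : ℝ} (ha : 1 < a) (hb : 0 < b) (hb1 : b < 1) (hs : 0 < s) :
    ∃ t ∈ Ioo 0 s, (1 - t) ^ b + t ^ a < 1 := by
  obtain ⟨t, h1, h2⟩ := ((eventually_rpow_add_rpow_lt_one ha hb hb1).and
    (Ioo_mem_nhdsGT hs)).exists
  exact ⟨t, h2, h1⟩

theorem exists_large_one_lt {a b s : ℝ} (ha : 1 < a) (hb1 : b < 1) (hs : s < 1) :
    ∃ t ∈ Ioo s 1, 1 < (1 - t) ^ b + t ^ a := by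
  obtain ⟨t, h1, h2⟩ := ((eventually_one_lt_rpow_add_rpow ha hb1).and
    (Ioo_mem_nhdsGT (sub_pos.2 hs))).exists
  exact ⟨1 - t, ⟨by linarith [h2.2], by linarith [h2.1]⟩, by simpa using h1⟩

/-- Between a point below and a point above the level `1` there is a crossing. -/
theorem exists_isCrossingOne {a b s t : ℝ} (ha : 0 < a) (hb : 0 < b) (hs : s ∈ Ioo (0 : ℝ) 1)
    (ht : t ∈ Ioo (0 : ℝ) 1) (h1 : (1 - s) ^ b + s ^ a < 1) (h2 : 1 < (1 - t) ^ b + t ^ a) :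
    ∃ x ∈ uIcc s t, x ≠ t ∧ IsCrossingOne a b x := by
  obtain ⟨x, hx, hx1⟩ := intermediate_value_uIcc
    (continuous_rpow_add_rpow ha.le hb.le).continuousOn
    (show (1 : ℝ) ∈ uIcc ((1 - s) ^ b + s ^ a) ((1 - t) ^ b + t ^ a) from
      mem_uIcc_of_le h1.le h2.le)
  exact ⟨x, hx, by rintro rfl; simp only at hx1; linarith, ordConnected_Ioo.uIcc_subset hs ht hx,
    hx1.symm⟩

theorem existsUnique_isCrossingOne {a b : ℝ} (ha : 1 < a) (hb : 0 < b) (hb1 : b < 1) :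
    ∃! x, IsCrossingOne a b x := by
  obtain ⟨s, hs, hs1⟩ := exists_small_lt_one ha hb hb1 zero_lt_one
  obtain ⟨t, ht, ht1⟩ := exists_large_one_lt ha hb1 zero_lt_one
  obtain ⟨x, -, -, hx⟩ := exists_isCrossingOne (by linarith) hb hs ht hs1 ht1
  exact ⟨x, hx, fun y hy ↦ isCrossingOne_unique ha hb hb1 hy hx⟩

/-- The strict inequality holds near 0. If it failed at s, the intermediate value theorem would give
a second crossing at or to the left of s. -/
theorem rpow_lt_of_lt_crossing {a b x s : ℝ} (ha : 1 < a) (hb : 0 < b) (hb1 : b < 1)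
    (hx : IsCrossingOne a b x) (hs0 : 0 < s) (hs : s < x) : s ^ a < 1 - (1 - s) ^ b := by
  by_contra! h
  have hs1 : s < 1 := hs.trans hx.1.2
  rcases h.eq_or_lt with h | h
  · exact hs.ne (isCrossingOne_unique ha hb hb1 ⟨⟨hs0, hs1⟩, by linarith⟩ hx)
  · obtain ⟨t, ht, ht1⟩ := exists_small_lt_one ha hb hb1 hs0
    obtain ⟨y, hy, -, hyc⟩ := exists_isCrossingOne (by linarith) hb
      ⟨ht.1, ht.2.trans hs1⟩ ⟨hs0, hs1⟩ ht1 (by linarith)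
    rw [uIcc_of_le ht.2.le] at hy
    exact (hy.2.trans_lt hs).ne (isCrossingOne_unique ha hb hb1 hyc hx)

theorem lt_rpow_of_crossing_lt {a b x s : ℝ} (ha : 1 < a) (hb : 0 < b) (hb1 : b < 1)
    (hx : IsCrossingOne a b x) (hs : x < s) (hs1 : s < 1) : 1 - (1 - s) ^ b < s ^ a := by
  by_contra! h
  have hs0 : 0 < s := hx.1.1.trans hs
  rcases h.eq_or_lt with h | h
  · exact hs.ne' (isCrossingOne_unique ha hb hb1 ⟨⟨hs0, hs1⟩, by linarith⟩ hx)
  · obtain ⟨t, ht, ht1⟩ := exists_large_one_lt ha hb1 hs1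
    obtain ⟨y, hy, -, hyc⟩ := exists_isCrossingOne (by linarith) hb
      ⟨hs0, hs1⟩ ⟨hs0.trans ht.1, ht.2⟩ (by linarith) ht1
    rw [uIcc_of_le ht.1.le] at hy
    exact (hs.trans_le hy.1).ne' (isCrossingOne_unique ha hb hb1 hyc hx)

/-! ### The one-dimensional example and its energy. -/

theorem minPow_of_le {a b x s : ℝ} (ha : 1 < a) (hb : 0 < b) (hb1 : b < 1)
    (hx : IsCrossingOne a b x) (hs0 : 0 < s) (hs : s < x) : minPow a b s = s ^ a :=
  min_eq_left (rpow_lt_of_lt_crossing ha hb hb1 hx hs0 hs).le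

theorem minPow_of_ge {a b x s : ℝ} (ha : 1 < a) (hb : 0 < b) (hb1 : b < 1)
    (hx : IsCrossingOne a b x) (hs : x < s) (hs1 : s < 1) : minPow a b s = 1 - (1 - s) ^ b :=
  min_eq_right (lt_rpow_of_crossing_lt ha hb hb1 hx hs hs1).le

/-- The derivative of `minPow a b` away from the crossing point `x`. -/
noncomputable def minPowDeriv (a b x s : ℝ) : ℝ :=
  if s < x then a * s ^ (a - 1) else b * (1 - s) ^ (b - 1)

theorem measurable_minPowDeriv (a b x : ℝ) : Measurable (minPowDeriv a b x) :=
  Measurable.ite measurableSet_Iio (by fun_prop) (by fun_prop)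

theorem hasDerivAt_minPow {a b x s : ℝ} (ha : 1 < a) (hb : 0 < b) (hb1 : b < 1)
    (hx : IsCrossingOne a b x) (hs : s ∈ Ioo (0 : ℝ) 1) (hsx : s ≠ x) :
    HasDerivAt (minPow a b) (minPowDeriv a b x s) s := by
  rcases hsx.lt_or_gt with h | h
  · rw [minPowDeriv, if_pos h]
    refine (Real.hasDerivAt_rpow_const (Or.inl hs.1.ne')).congr_of_eventuallyEq ?_
    filter_upwards [Ioo_mem_nhds hs.1 h] with t ht
    exact minPow_of_le ha hb hb1 hx ht.1 ht.2
  · rw [minPowDeriv, if_neg h.le.not_gt]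
    have : HasDerivAt (fun s : ℝ ↦ 1 - (1 - s) ^ b) (b * (1 - s) ^ (b - 1)) s :=
      ((hasDerivAt_one_sub_rpow hs.2).const_sub 1).congr_deriv (by ring)
    refine this.congr_of_eventuallyEq ?_
    filter_upwards [Ioo_mem_nhds h hs.2] with t ht
    exact minPow_of_ge ha hb hb1 hx ht.1 ht.2

theorem continuous_minPow {a b : ℝ} (ha : 0 < a) (hb : 0 < b) : Continuous (minPow a b) :=
  (Real.continuous_rpow_const ha.le).min
    (continuous_const.sub ((Real.continuous_rpow_const hb.le).comp (by fun_prop)))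

theorem minPow_zero {a b : ℝ} (ha : a ≠ 0) : minPow a b 0 = 0 := by
  simp [minPow, Real.zero_rpow ha]

theorem minPow_one {a b : ℝ} (hb : b ≠ 0) : minPow a b 1 = 1 := by
  simp [minPow, Real.zero_rpow hb]

/-- This makes the competitor's test function s - w(s) nonzero on the whole annulus, so that the
full energies are compared. -/
theorem minPow_lt_self {a b s : ℝ} (ha : 1 < a) (hs : s ∈ Ioo (0 : ℝ) 1) : minPow a b s < s := by
  refine (min_le_left _ _).trans_lt ?_
  simpa using Real.rpow_lt_rpow_of_exponent_gt hs.1 hs.2 ha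

/-- Since b < 1, the derivative is unbounded near 1, so the bound must depend on r. -/
theorem abs_minPowDeriv_le {a b x l r s : ℝ} (ha : 1 < a) (hb : 0 < b) (hb1 : b < 1)
    (hl : 0 < l) (hr : r < 1) (hs : s ∈ Icc l r) :
    |minPowDeriv a b x s| ≤ a + b * (1 - r) ^ (b - 1) := by
  have h0 : 0 < s := hl.trans_le hs.1
  have h1 : s < 1 := hs.2.trans_lt hr
  have h2 : 0 < 1 - r := by linarith
  have h3 : 0 < b * (1 - r) ^ (b - 1) := mul_pos hb (Real.rpow_pos_of_pos h2 _)
  unfold minPowDeriv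
  split_ifs
  · rw [abs_of_nonneg (by positivity)]
    have : s ^ (a - 1) ≤ 1 := Real.rpow_le_one h0.le h1.le (by linarith)
    nlinarith
  · have h5 : 0 < 1 - s := by linarith
    have : 0 < (1 - s) ^ (b - 1) := Real.rpow_pos_of_pos h5 _
    rw [abs_of_nonneg (by positivity)]
    have := Real.rpow_le_rpow_of_nonpos h2 (by linarith [hs.2] : 1 - r ≤ 1 - s)
      (by linarith : b - 1 ≤ 0)
    nlinarith

theorem lintegral_rpow_Ioo {r x : ℝ} (hr : -1 < r) (hx : 0 < x) :
    ∫⁻ s in Ioo 0 x, ENNReal.ofReal (s ^ r) = ENNReal.ofReal (x ^ (r + 1) / (r + 1)) := by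
  rw [restrict_Ioo_eq_restrict_Ioc, ← ofReal_integral_eq_lintegral_ofReal,
    ← intervalIntegral.integral_of_le hx.le, integral_rpow (Or.inl hr),
    Real.zero_rpow (by linarith), sub_zero]
  · exact (intervalIntegrable_iff_integrableOn_Ioc_of_le hx.le).1
      (intervalIntegral.intervalIntegrable_rpow' hr)
  · filter_upwards [ae_restrict_mem measurableSet_Ioc] with s hs
    exact Real.rpow_nonneg hs.1.le _

theorem lintegral_one_sub_rpow_Ioo {r x : ℝ} (hr : -1 < r) (hx : x < 1) :
    ∫⁻ s in Ioo x 1, ENNReal.ofReal ((1 - s) ^ r) =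
      ENNReal.ofReal ((1 - x) ^ (r + 1) / (r + 1)) := by
  rw [← lintegral_rpow_Ioo hr (sub_pos.2 hx), ← lintegral_indicator measurableSet_Ioo,
    ← lintegral_indicator measurableSet_Ioo, ← lintegral_sub_left_eq_self _ (1 : ℝ)]
  congr 1
  ext s
  simp only [indicator, mem_Ioo, sub_sub_cancel]
  congr 1
  exact propext ⟨fun h ↦ ⟨by linarith, by linarith⟩, fun h ↦ ⟨by linarith, by linarith⟩⟩

theorem enorm_mul_rpow_rpow {c t e : ℝ} (n : ℕ) (hc : 0 ≤ c) (ht : 0 ≤ t) :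
    ‖c * t ^ e‖ₑ ^ (n : ℝ) =
      ENNReal.ofReal (c ^ (n : ℝ)) * ENNReal.ofReal (t ^ ((n : ℝ) * e)) := by
  have : 0 ≤ c * t ^ e := by positivity
  rw [Real.enorm_eq_ofReal this, ENNReal.ofReal_rpow_of_nonneg this (by positivity),
    ← ENNReal.ofReal_mul (by positivity), Real.mul_rpow hc (by positivity), ← Real.rpow_mul ht,
    mul_comm e]

/-- The constants Q₁ and Q₂ appear because n(α-1)+1, the denominator produced by integrating the
power, is the denominator of `QConst`. The condition b > 1 - 1/n is exactly integrability at 1. -/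
theorem lintegral_minPowDeriv {n : ℕ} {Q₁ Q₂ a b x : ℝ} (hn : 2 ≤ n)
    (ha : IsUpperExponent n Q₁ a) (hb : IsLowerExponent n Q₂ b) (hx : x ∈ Ioo (0 : ℝ) 1) :
    ∫⁻ s in Ioo (0 : ℝ) 1, ‖minPowDeriv a b x s‖ₑ ^ (n : ℝ) =
      ENNReal.ofReal (Q₁ * x ^ ((n : ℝ) * (a - 1) + 1) +
        Q₂ * (1 - x) ^ ((n : ℝ) * (b - 1) + 1)) := by
  obtain ⟨ha1, rfl⟩ := ha
  obtain ⟨hb0, hb1, rfl⟩ := hb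
  have hn0 : (2 : ℝ) ≤ n := by exact_mod_cast hn
  have hna : 0 < (n : ℝ) * (a - 1) + 1 := by nlinarith
  have hnb : 0 < (n : ℝ) * (b - 1) + 1 := by
    have := mul_lt_mul_of_pos_left hb0 (by linarith : (0 : ℝ) < n)
    rw [mul_sub, mul_one_div_cancel (by linarith)] at this
    linarith
  have hbp : 0 < b := by
    have : 1 / (n : ℝ) ≤ 1 := by rw [div_le_one (by linarith)]; linarith
    linarith
  have hap : 0 < a := by linarith
  have hx' : 0 < 1 - x := by linarith [hx.2]
  have e1 : ∫⁻ s in Ioo 0 x, ‖minPowDeriv a b x s‖ₑ ^ (n : ℝ) =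
      ENNReal.ofReal (QConst n a * x ^ ((n : ℝ) * (a - 1) + 1)) := by
    rw [setLIntegral_congr_fun (g := fun s ↦ ENNReal.ofReal (a ^ (n : ℝ)) *
      ENNReal.ofReal (s ^ ((n : ℝ) * (a - 1)))) measurableSet_Ioo, lintegral_const_mul _
      (by fun_prop), lintegral_rpow_Ioo (by linarith) hx.1,
      ← ENNReal.ofReal_mul (Real.rpow_nonneg hap.le _),
      QConst, show (n : ℝ) * a - n + 1 = n * (a - 1) + 1 by ring]
    · congr 1; ring
    · intro s hs
      simp only
      rw [minPowDeriv, if_pos hs.2, enorm_mul_rpow_rpow n (by linarith) hs.1.le]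
  have e2 : ∫⁻ s in Ioo x 1, ‖minPowDeriv a b x s‖ₑ ^ (n : ℝ) =
      ENNReal.ofReal (QConst n b * (1 - x) ^ ((n : ℝ) * (b - 1) + 1)) := by
    rw [setLIntegral_congr_fun (g := fun s ↦ ENNReal.ofReal (b ^ (n : ℝ)) *
      ENNReal.ofReal ((1 - s) ^ ((n : ℝ) * (b - 1)))) measurableSet_Ioo, lintegral_const_mul _
      (by fun_prop), lintegral_one_sub_rpow_Ioo (by linarith) hx.2,
      ← ENNReal.ofReal_mul (Real.rpow_nonneg hbp.le _),
      QConst, show (n : ℝ) * b - n + 1 = n * (b - 1) + 1 by ring]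
    · congr 1; ring
    · intro s hs
      simp only
      rw [minPowDeriv, if_neg hs.1.le.not_gt, enorm_mul_rpow_rpow n hbp.le (by linarith [hs.2])]
  rw [restrict_Ioo_eq_restrict_Ioc, ← Ioc_union_Ioc_eq_Ioc hx.1.le hx.2.le,
    lintegral_union measurableSet_Ioc (Ioc_disjoint_Ioc_of_le le_rfl),
    ← restrict_Ioo_eq_restrict_Ioc, ← restrict_Ioo_eq_restrict_Ioc, e1, e2, ENNReal.ofReal_add]
  · exact mul_nonneg (div_nonneg (by positivity) (by linarith)) (Real.rpow_nonneg hx.1.le _)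
  · exact mul_nonneg (div_nonneg (by positivity) (by linarith)) (Real.rpow_nonneg hx'.le _)

/-! ### Weak gradients of radial functions. -/

/-- `Φ` is a continuous profile with derivative `D` on `(0, 1)` except at `c`, where `D` is bounded
on compact subintervals of `(0, 1)`. -/
structure IsProfile (Φ D : ℝ → ℝ) (c : ℝ) : Prop where
  cont : Continuous Φ
  meas : Measurable D
  hasDerivAt : ∀ s ∈ Ioo (0 : ℝ) 1, s ≠ c → HasDerivAt Φ (D s) s
  bdd : ∀ l r : ℝ, 0 < l → r < 1 → ∃ C, ∀ s ∈ Icc l r, |D s| ≤ C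

theorem IsProfile.exists_lipschitzOnWith {Φ D : ℝ → ℝ} {c : ℝ} (h : IsProfile Φ D c) {l r : ℝ}
    (hl : 0 < l) (hr : r < 1) : ∃ K, LipschitzOnWith K Φ (Icc l r) := by
  obtain ⟨C, hC⟩ := h.bdd l r hl hr
  refine ⟨C.toNNReal, LipschitzOnWith.of_dist_le_mul fun s hs t ht ↦ ?_⟩
  have hsub : uIcc t s ⊆ Icc l r := ordConnected_Icc.uIcc_subset ht hs
  have hint : IntervalIntegrable D volume t s := by
    rw [intervalIntegrable_iff]
    refine Measure.integrableOn_of_bounded (M := C) (by simp) h.meas.aestronglyMeasurable ?_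
    filter_upwards [ae_restrict_mem measurableSet_uIoc] with x hx
    exact hC x (hsub (uIoc_subset_uIcc hx))
  have hftc := integral_eq_of_hasDerivAt_off_countable Φ D (countable_singleton c)
    h.cont.continuousOn (fun x hx ↦ h.hasDerivAt x ?_ hx.2) hint
  · have hb := intervalIntegral.norm_integral_le_of_norm_le_const (a := t) (b := s) (f := D) (C := C)
      fun x hx ↦ hC x (hsub (uIoc_subset_uIcc hx))
    rw [hftc] at hb
    rw [dist_eq_norm, Real.dist_eq]
    exact hb.trans (mul_le_mul_of_nonneg_right (Real.le_coe_toNNReal C) (abs_nonneg _))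
  · have : x ∈ Icc l r := hsub (Ioo_subset_Icc_self hx.1)
    exact ⟨hl.trans_le this.1, this.2.trans_lt hr⟩

theorem hasFDerivAt_logRadius {n : ℕ} {x : RSpace n} (hx : x ≠ 0) :
    HasFDerivAt (logRadius : RSpace n → ℝ) ((‖x‖ ^ 2)⁻¹ • innerSL ℝ x) x := by
  have h1 := ((hasStrictFDerivAt_norm_sq x).hasFDerivAt.log
    (pow_ne_zero 2 (norm_ne_zero_iff.2 hx))).const_mul (1 / 2)
  have h2 := h1.const_add 1
  -- Writing log|x| as half of log|x|² replaces the norm by its smooth square.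
  have e : (logRadius : RSpace n → ℝ) = fun x ↦ 1 + 1 / 2 * Real.log (‖x‖ ^ 2) := by
    ext y
    rw [logRadius, Real.log_pow]
    push_cast
    ring
  rw [e]
  refine h2.congr_fderiv ?_
  ext y
  simp
  ring

theorem hasGradientAt_comp_logRadius {n : ℕ} {Φ : ℝ → ℝ} {d : ℝ} {x : RSpace n} (hx : x ≠ 0)
    (h : HasDerivAt Φ d (logRadius x)) :
    HasGradientAt (fun x : RSpace n ↦ Φ (logRadius x)) ((d / ‖x‖ ^ 2) • x) x := by
  rw [hasGradientAt_iff_hasFDerivAt]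
  refine (h.comp_hasFDerivAt x (hasFDerivAt_logRadius hx)).congr_fderiv ?_
  ext y
  simp [div_eq_mul_inv]
  ring

theorem continuousOn_logRadius (n : ℕ) : ContinuousOn (logRadius : RSpace n → ℝ) (annulusA n) :=
  fun _ hx ↦ (hasFDerivAt_logRadius
    (norm_pos_iff.1 (mem_annulusA_pos hx))).continuousAt.continuousWithinAt

theorem lipschitzOnWith_logRadius (n : ℕ) :
    ∃ K, LipschitzOnWith K (logRadius : RSpace n → ℝ) (annulusA n) := by
  have key : ∀ x ∈ annulusA n, ∀ y ∈ annulusA n,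
      logRadius x - logRadius y ≤ Real.exp 1 * dist x y := by
    intro x hx y hy
    have h1 := mem_annulusA_pos hx
    have h2 := mem_annulusA_pos hy
    have h3 := Real.log_le_sub_one_of_pos (div_pos h1 h2)
    rw [Real.log_div h1.ne' h2.ne'] at h3
    have h4 : ‖x‖ / ‖y‖ - 1 = (‖x‖ - ‖y‖) * ‖y‖⁻¹ := by field_simp
    have h5 : ‖y‖⁻¹ ≤ Real.exp 1 := inv_le_of_inv_le₀ (Real.exp_pos 1) hy.1.le
    have h6 : ‖x‖ - ‖y‖ ≤ dist x y := by rw [dist_eq_norm]; exact norm_sub_norm_le x y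
    have h7 : (‖x‖ - ‖y‖) * ‖y‖⁻¹ ≤ dist x y * Real.exp 1 :=
      mul_le_mul h6 h5 (by positivity) dist_nonneg
    simp only [logRadius]
    linarith
  refine ⟨(Real.exp 1).toNNReal, LipschitzOnWith.of_dist_le_mul fun x hx y hy ↦ ?_⟩
  rw [Real.coe_toNNReal _ (Real.exp_pos 1).le, Real.dist_eq, abs_le]
  have := key x hx y hy
  have := key y hy x hx
  rw [dist_comm y x] at this
  constructor <;> linarith

theorem exists_Ioo_of_isCompact_subset {T : Set ℝ} (hT : IsCompact T) (h : T ⊆ Ioo 0 1) :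
    ∃ l r : ℝ, 0 < l ∧ r < 1 ∧ T ⊆ Ioo l r := by
  rcases T.eq_empty_or_nonempty with rfl | hne
  · exact ⟨1 / 2, 1 / 2, by norm_num, by norm_num, empty_subset _⟩
  · have h1 := h (hT.sInf_mem hne)
    have h2 := h (hT.sSup_mem hne)
    refine ⟨sInf T / 2, (1 + sSup T) / 2, by linarith [h1.1], by linarith [h2.2], fun x hx ↦ ?_⟩
    have h3 := csInf_le hT.bddBelow hx
    have h4 := le_csSup hT.bddAbove hx
    exact ⟨by linarith [h1.1], by linarith [h2.2]⟩

theorem ae_logRadius_ne {n : ℕ} (hn : n ≠ 0) (c : ℝ) :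
    ∀ᵐ x ∂(volume : Measure (RSpace n)), x ≠ 0 → logRadius x ≠ c := by
  have : Nonempty (Fin n) := ⟨⟨0, Nat.pos_of_ne_zero hn⟩⟩
  have h := Measure.addHaar_sphere (volume : Measure (RSpace n)) 0 (Real.exp (c - 1))
  filter_upwards [compl_mem_ae_iff.2 h] with x hx h0 hc
  refine hx ?_
  rw [mem_sphere_zero_iff_norm, ← hc, logRadius, add_sub_cancel_left,
    Real.exp_log (norm_pos_iff.2 h0)]

/-- On the compact support of a test function, s stays in some [l, r] inside (0,1), where Φ is
Lipschitz. The radial function therefore agrees near that support with a globally Lipschitz v, for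
which integration by parts is available. The line derivative of v is the classical one off the
sphere s = c, which is null. -/
theorem hasWeakGradient_radial {n : ℕ} (hn : 2 ≤ n) {Φ D : ℝ → ℝ} {c : ℝ} (h : IsProfile Φ D c)
    (hD : MemLp (radialGrad D) (ENNReal.ofReal n) (volume.restrict (annulusA n))) :
    HasWeakGradient (annulusA n) (fun x ↦ Φ (logRadius x)) (radialGrad D) := by
  have hA := (isOpen_annulusA n).measurableSet
  have : IsFiniteMeasure (volume.restrict (annulusA n)) :=
    ⟨by simpa using volume_annulusA_lt_top n⟩
  refine ⟨(h.cont.comp_continuousOn (continuousOn_logRadius n)).locallyIntegrableOn hA,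
    IntegrableOn.locallyIntegrableOn (hD.integrable ?_), ?_⟩
  · rw [ENNReal.one_le_ofReal]
    exact_mod_cast (by omega : 1 ≤ n)
  rintro ψ ⟨hψ, hψc, hψA⟩ y
  obtain ⟨l, r, hl, hr, hT⟩ := exists_Ioo_of_isCompact_subset
    (hψc.isCompact.image_of_continuousOn ((continuousOn_logRadius n).mono hψA))
    (image_subset_iff.2 fun x hx ↦ logRadius_mem (hψA hx))
  set S : Set (RSpace n) := annulusA n ∩ logRadius ⁻¹' Icc l r with hS
  obtain ⟨K, hK⟩ := h.exists_lipschitzOnWith hl hr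
  obtain ⟨L, hL⟩ := lipschitzOnWith_logRadius n
  obtain ⟨v, hv, hveq⟩ := (hK.comp (hL.mono inter_subset_left)
    (fun x (hx : x ∈ S) ↦ hx.2)).extend_real
  obtain ⟨M, hM⟩ := ContDiff.lipschitzWith_of_hasCompactSupport hψc hψ (by simp)
  have hmem : ∀ x ∈ tsupport ψ, logRadius x ∈ Ioo l r := fun x hx ↦ hT ⟨x, hx, rfl⟩
  have e1 : ∫ x in annulusA n, Φ (logRadius x) * fderiv ℝ ψ x y = ∫ x, v x * fderiv ℝ ψ x y := by
    refine Eq.trans ?_ (setIntegral_eq_integral_of_forall_compl_eq_zero (s := annulusA n) ?_)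
    · refine setIntegral_congr_fun hA fun x hx ↦ ?_
      by_cases hxs : x ∈ tsupport ψ
      · have : x ∈ S := ⟨hx, Ioo_subset_Icc_self (hmem x hxs)⟩
        rw [← hveq this]
        rfl
      · simp [fderiv_of_notMem_tsupport ℝ hxs]
    · intro x hx
      simp [fderiv_of_notMem_tsupport ℝ fun hxs ↦ hx (hψA hxs)]
  have e2 : ∫ x in annulusA n, inner ℝ (radialGrad D x) y * ψ x =
      ∫ x, lineDeriv ℝ v x y * ψ x := by
    refine Eq.trans ?_ (setIntegral_eq_integral_of_forall_compl_eq_zero (s := annulusA n) ?_)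
    · refine setIntegral_congr_ae hA ?_
      filter_upwards [ae_logRadius_ne (by omega : n ≠ 0) c] with x hxc hx
      by_cases hxs : x ∈ tsupport ψ
      · have hx0 : x ≠ 0 := norm_pos_iff.1 (mem_annulusA_pos hx)
        have hd := hasGradientAt_comp_logRadius hx0 (h.hasDerivAt _ (logRadius_mem hx) (hxc hx0))
        have hev : v =ᶠ[𝓝 x] fun x ↦ Φ (logRadius x) := by
          filter_upwards [(isOpen_annulusA n).mem_nhds hx,
            (hasFDerivAt_logRadius hx0).continuousAt.preimage_mem_nhds
              (Ioo_mem_nhds (hmem x hxs).1 (hmem x hxs).2)] with z hz hz'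
          exact (hveq ⟨hz, Ioo_subset_Icc_self hz'⟩).symm
        have := ((hd.hasFDerivAt.congr_of_eventuallyEq hev).hasLineDerivAt y).lineDeriv
        rw [this]
        rfl
      · simp [image_eq_zero_of_notMem_tsupport hxs]
    · intro x hx
      simp [image_eq_zero_of_notMem_tsupport fun hxs ↦ hx (hψA hxs)]
  rw [e1, e2, LipschitzWith.integral_lineDeriv_mul_eq hv hM hψc, ← integral_neg]
  congr 1
  ext x
  rw [((hψ.differentiable (by simp)) x).lineDeriv_eq_fderiv, map_neg]
  ring

/-- Weak gradients are unique up to null sets. -/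
theorem HasWeakGradient.ae_eq {n : ℕ} {Ω : Set (RSpace n)} (hΩ : IsOpen Ω) {u : RSpace n → ℝ}
    {g h : RSpace n → RSpace n} (hg : HasWeakGradient Ω u g) (hh : HasWeakGradient Ω u h) :
    g =ᵐ[volume.restrict Ω] h := by
  have hint : ∀ f : RSpace n → RSpace n, LocallyIntegrableOn f Ω volume → ∀ ψ : RSpace n → ℝ,
      IsTestFunction Ω ψ → IntegrableOn (fun x ↦ ψ x • f x) Ω volume := by
    rintro f hf ψ ⟨hψ, hψc, hψA⟩
    have h1 := (hf.integrableOn_compact_subset hψA hψc.isCompact).continuousOn_smul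
      hψ.continuous.continuousOn hψc.isCompact
    refine IntegrableOn.integrable_of_forall_notMem_eq_zero h1 (fun x hx ↦ ?_) |>.integrableOn
    simp [image_eq_zero_of_notMem_tsupport hx]
  have key := hΩ.ae_eq_zero_of_integral_contDiff_smul_eq_zero (f := fun x ↦ g x - h x)
    (hg.2.1.sub hh.2.1) fun ψ hψ hψc hψA ↦ ?_
  · filter_upwards [ae_restrict_of_ae key, ae_restrict_mem hΩ.measurableSet] with x hx hxΩ
    exact sub_eq_zero.1 (hx hxΩ)
  · have hψ' : IsTestFunction Ω ψ := ⟨hψ, hψc, hψA⟩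
    rw [← setIntegral_eq_integral_of_forall_compl_eq_zero (s := Ω)
      fun x hx ↦ by simp [image_eq_zero_of_notMem_tsupport fun hxs ↦ hx (hψA hxs)]]
    simp_rw [smul_sub]
    rw [integral_sub (hint g hg.2.1 ψ hψ') (hint h hh.2.1 ψ hψ'), sub_eq_zero]
    refine ext_inner_left ℝ fun y ↦ ?_
    rw [← integral_inner (hint g hg.2.1 ψ hψ'), ← integral_inner (hint h hh.2.1 ψ hψ')]
    have := (hg.2.2 ψ hψ' y).symm.trans (hh.2.2 ψ hψ' y)
    simp_rw [inner_smul_right, real_inner_comm _ y]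
    simpa [mul_comm] using this

theorem HasWeakGradient.pEnergy_eq {n : ℕ} {Ω : Set (RSpace n)} (hΩ : IsOpen Ω) {u : RSpace n → ℝ}
    {g h : RSpace n → RSpace n} (hg : HasWeakGradient Ω u g) (hh : HasWeakGradient Ω u h) (p : ℝ) :
    pEnergy Ω p g = pEnergy Ω p h := by
  refine lintegral_congr_ae ?_
  filter_upwards [hg.ae_eq hΩ hh] with x hx
  rw [hx]

/-! ### Approximation by test functions and zero boundary values. -/

/-- Functions in `L^p(0, 1)` can be approximated by smooth functions supported away from the
endpoints. -/
theorem exists_contDiff_eLpNorm_sub_le {p : ℝ≥0∞} (hp : 1 ≤ p) (hp' : p ≠ ∞) {f : ℝ → ℝ}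
    (hf : MemLp f p (volume.restrict (Ioo 0 1))) {ε : ℝ} (hε : 0 < ε) :
    ∃ h : ℝ → ℝ, ContDiff ℝ ((⊤ : ℕ∞) : WithTop ℕ∞) h ∧
      (∃ δ : ℝ, 0 < δ ∧ δ < 1 / 2 ∧ ∀ s, s ∉ Icc δ (1 - δ) → h s = 0) ∧
      eLpNorm (f - h) p (volume.restrict (Ioo 0 1)) ≤ ENNReal.ofReal ε := by
  obtain ⟨η, hη, hη'⟩ := hf.eLpNorm_indicator_le hp hp' (half_pos hε)
  -- The two removed end intervals have total length 2δ ≤ η, so f has small norm on them.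
  set δ : ℝ := min (1 / 4) (η / 2) with hδ
  have hδ0 : 0 < δ := lt_min (by norm_num) (by positivity)
  have hδ1 : δ ≤ 1 / 4 := min_le_left _ _
  have hδ2 : δ ≤ η / 2 := min_le_right _ _
  set I : Set ℝ := Icc δ (1 - δ) with hI
  have hIm : MeasurableSet I := measurableSet_Icc
  have hmeas : volume.restrict (Ioo (0 : ℝ) 1) Iᶜ ≤ ENNReal.ofReal η := by
    rw [Measure.restrict_apply hIm.compl]
    have hsub : Iᶜ ∩ Ioo 0 1 ⊆ Ioo 0 δ ∪ Ioo (1 - δ) 1 := by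
      rintro s ⟨hs, hs'⟩
      by_cases h : s < δ
      · exact Or.inl ⟨hs'.1, h⟩
      · exact Or.inr ⟨by by_contra! h'; exact hs ⟨not_lt.1 h, h'⟩, hs'.2⟩
    refine (measure_mono hsub).trans ((measure_union_le _ _).trans ?_)
    rw [Real.volume_Ioo, Real.volume_Ioo, ← ENNReal.ofReal_add (by linarith) (by linarith)]
    exact ENNReal.ofReal_le_ofReal (by linarith)
  have hcut := hη' _ hIm.compl hmeas
  have hfI : MemLp (I.indicator f) p (volume.restrict (Ioo 0 1)) := hf.indicator hIm
  obtain ⟨g, hgc, hg, hfg⟩ := hfI.exist_eLpNorm_sub_le hp' hp (half_pos hε)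
  let χ : ContDiffBump (1 / 2 : ℝ) := ⟨1 / 2 - δ, 1 / 2 - δ / 2, by linarith, by linarith⟩
  have hχI : ∀ s ∈ I, χ s = 1 := fun s hs ↦ χ.one_of_mem_closedBall <| by
    rw [Metric.mem_closedBall, Real.dist_eq, abs_le]
    change -(1 / 2 - δ) ≤ _ ∧ _ ≤ 1 / 2 - δ
    constructor <;> linarith [hs.1, hs.2]
  refine ⟨fun s ↦ χ s * g s, χ.contDiff.mul hg, ⟨δ / 2, by positivity, by linarith, fun s hs ↦ ?_⟩,
    ?_⟩
  · change χ s * g s = 0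
    rw [χ.zero_of_le_dist, zero_mul]
    change 1 / 2 - δ / 2 ≤ _
    by_contra! h
    rw [Real.dist_eq, abs_lt] at h
    exact hs ⟨by linarith [h.1], by linarith [h.2]⟩
  · have hdec : f - (fun s ↦ χ s * g s) = Iᶜ.indicator f + fun s ↦ χ s * (I.indicator f - g) s := by
      ext s
      by_cases hs : s ∈ I
      · simp [hs, hχI s hs]
      · simp [hs, sub_eq_add_neg]
    have hsm : AEStronglyMeasurable (I.indicator f - g) (volume.restrict (Ioo 0 1)) :=
      hfI.aestronglyMeasurable.sub hg.continuous.aestronglyMeasurable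
    rw [hdec]
    refine (eLpNorm_add_le (hf.indicator hIm.compl).aestronglyMeasurable
      (χ.continuous.aestronglyMeasurable.mul hsm) hp).trans ?_
    rw [← add_halves ε, ENNReal.ofReal_add (half_pos hε).le (half_pos hε).le]
    refine add_le_add hcut ((eLpNorm_mono fun s ↦ ?_).trans hfg)
    rw [Pi.mul_apply, norm_mul, Real.norm_of_nonneg χ.nonneg]
    exact mul_le_of_le_one_left (norm_nonneg _) χ.le_one

instance isProbabilityMeasure_restrict_Ioo :
    IsProbabilityMeasure (volume.restrict (Ioo (0 : ℝ) 1)) := ⟨by simp⟩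

theorem enorm_integral_le_eLpNorm {p : ℝ≥0∞} (hp : 1 ≤ p) {f : ℝ → ℝ}
    (hf : AEStronglyMeasurable f (volume.restrict (Ioo 0 1))) :
    ‖∫ s in Ioo 0 1, f s‖ₑ ≤ eLpNorm f p (volume.restrict (Ioo 0 1)) := by
  refine (enorm_integral_le_lintegral_enorm f).trans ?_
  rw [← eLpNorm_one_eq_lintegral_enorm]
  exact eLpNorm_le_eLpNorm_of_exponent_le hp hf

/-- Mean-zero functions in `L^p(0, 1)` can be approximated by derivatives of smooth functions
supported away from the endpoints. -/
theorem exists_contDiff_eLpNorm_sub_deriv_le {p : ℝ≥0∞} (hp : 1 ≤ p) (hp' : p ≠ ∞) {f : ℝ → ℝ}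
    (hf : MemLp f p (volume.restrict (Ioo 0 1))) (hf0 : ∫ s in Ioo 0 1, f s = 0) {ε : ℝ}
    (hε : 0 < ε) :
    ∃ Ψ : ℝ → ℝ, ContDiff ℝ ((⊤ : ℕ∞) : WithTop ℕ∞) Ψ ∧
      (∃ δ : ℝ, 0 < δ ∧ δ < 1 / 2 ∧ ∀ s, s ∉ Icc δ (1 - δ) → Ψ s = 0) ∧
      eLpNorm (f - deriv Ψ) p (volume.restrict (Ioo 0 1)) ≤ ENNReal.ofReal ε := by
  let χ : ContDiffBump (1 / 2 : ℝ) := ⟨1 / 8, 1 / 4, by norm_num, by norm_num⟩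
  set b : ℝ → ℝ := χ.normed volume with hb
  have hbs : ContDiff ℝ ((⊤ : ℕ∞) : WithTop ℕ∞) b := χ.contDiff_normed
  have hb0 : ∀ s, s ∉ Icc (1 / 4 : ℝ) (3 / 4) → b s = 0 := fun s hs ↦ by
    have : s ∉ Function.support b := by
      rw [hb, χ.support_normed_eq, Metric.mem_ball, Real.dist_eq, abs_lt]
      rintro ⟨h1, h2⟩
      change -(1 / 4) < _ at h1
      change _ < 1 / 4 at h2
      exact hs ⟨by linarith, by linarith⟩
    simpa using this
  have hb1 : ∫ s in Ioo 0 1, b s = 1 := by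
    rw [setIntegral_eq_integral_of_forall_compl_eq_zero, hb, χ.integral_normed]
    intro s hs
    exact hb0 s fun h ↦ hs ⟨by linarith [h.1], by linarith [h.2]⟩
  have hbp : MemLp b p (volume.restrict (Ioo 0 1)) :=
    (hbs.continuous.memLp_of_hasCompactSupport χ.hasCompactSupport_normed).restrict _
  set B : ℝ := (eLpNorm b p (volume.restrict (Ioo 0 1))).toReal with hB
  have hBe : eLpNorm b p (volume.restrict (Ioo 0 1)) = ENNReal.ofReal B :=
    (ENNReal.ofReal_toReal hbp.eLpNorm_ne_top).symm
  have hB0 : 0 ≤ B := ENNReal.toReal_nonneg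
  -- The error is at most ε' from h plus |κ|B ≤ ε'B from the mean correction.
  set ε' : ℝ := ε / (1 + B) with hε'
  have hε'0 : 0 < ε' := by positivity
  obtain ⟨h, hh, ⟨δ, hδ0, hδ1, hδ⟩, hfh⟩ := exists_contDiff_eLpNorm_sub_le hp hp' hf hε'0
  have hhint : IntegrableOn h (Ioo 0 1) :=
    (hh.continuous.integrableOn_Icc (a := 0) (b := 1)).mono_set Ioo_subset_Icc_self
  have hbint : IntegrableOn b (Ioo 0 1) := hbp.integrable hp
  set κ : ℝ := ∫ s in Ioo 0 1, h s with hκ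
  have hκε : |κ| ≤ ε' := by
    have h1 := (enorm_integral_le_eLpNorm hp (hf.aestronglyMeasurable.sub
      hh.continuous.aestronglyMeasurable)).trans hfh
    simp only [Pi.sub_apply] at h1
    rw [integral_sub (hf.integrable hp) hhint, hf0, zero_sub, enorm_neg, ← ofReal_norm] at h1
    exact (ENNReal.ofReal_le_ofReal_iff hε'0.le).1 h1
  -- Removing the small mean κ of h with a bump of integral 1 makes the primitive of k vanish near 1
  -- as well as near 0.
  set k : ℝ → ℝ := fun s ↦ h s - κ * b s with hk
  have hks : ContDiff ℝ ((⊤ : ℕ∞) : WithTop ℕ∞) k := hh.sub (contDiff_const.mul hbs)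
  have hk0 : ∀ s, s ∉ Icc (min δ (1 / 4)) (1 - min δ (1 / 4)) → k s = 0 := by
    intro s hs
    have e1 := min_le_left δ (1 / 4)
    have e2 := min_le_right δ (1 / 4)
    simp only [hk]
    rw [hδ s fun h ↦ hs ⟨by linarith [h.1], by linarith [h.2]⟩,
      hb0 s fun h ↦ hs ⟨by linarith [h.1], by linarith [h.2]⟩, mul_zero, sub_zero]
  have hkint : ∫ s in (0 : ℝ)..1, k s = 0 := by
    rw [intervalIntegral.integral_of_le zero_le_one, ← restrict_Ioo_eq_restrict_Ioc, hk,
      integral_sub hhint (hbint.const_mul κ), integral_const_mul, hb1, mul_one, sub_self]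
  have hderiv : ∀ s, HasDerivAt (fun s ↦ ∫ t in (0 : ℝ)..s, k t) (k s) s := fun s ↦
    intervalIntegral.integral_hasDerivAt_right (hks.continuous.intervalIntegrable _ _)
      (hks.continuous.stronglyMeasurableAtFilter _ _) hks.continuous.continuousAt
  have hderiv' : deriv (fun s ↦ ∫ t in (0 : ℝ)..s, k t) = k := funext fun s ↦ (hderiv s).deriv
  have hm0 : 0 < min δ (1 / 4) := lt_min hδ0 (by norm_num)
  refine ⟨fun s ↦ ∫ t in (0 : ℝ)..s, k t, ?_, ⟨min δ (1 / 4), hm0,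
    (min_le_right _ _).trans_lt (by norm_num), fun s hs ↦ ?_⟩, ?_⟩
  · rw [contDiff_infty_iff_deriv, hderiv']
    exact ⟨fun s ↦ (hderiv s).differentiableAt, hks⟩
  · rcases not_and_or.1 hs with h1 | h1
    · refine intervalIntegral.integral_zero_ae (Eventually.of_forall fun t ht ↦ hk0 t fun h ↦ ?_)
      have := ht.2
      rcases le_max_iff.1 this with h2 | h2
      · linarith [h.1]
      · exact h1 (h.1.trans h2)
    · have h2 : ∫ t in (1 : ℝ)..s, k t = 0 := by
        refine intervalIntegral.integral_zero_ae (Eventually.of_forall fun t ht ↦ hk0 t fun h ↦ ?_)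
        rcases min_lt_iff.1 ht.1 with h2 | h2
        · linarith [h.2]
        · exact h1 (h2.le.trans h.2)
      beta_reduce
      rw [← intervalIntegral.integral_add_adjacent_intervals
        (hks.continuous.intervalIntegrable 0 1) (hks.continuous.intervalIntegrable 1 s), hkint, h2,
        add_zero]
  · rw [hderiv']
    have hdec : f - k = (f - h) + κ • b := by
      ext s
      simp [hk]
      ring
    rw [hdec]
    refine (eLpNorm_add_le (hf.aestronglyMeasurable.sub hh.continuous.aestronglyMeasurable)
      (hbp.aestronglyMeasurable.const_smul κ) hp).trans ?_
    rw [eLpNorm_const_smul, hBe, ← ofReal_norm, ← ENNReal.ofReal_mul (norm_nonneg _)]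
    refine (add_le_add_left hfh _).trans ?_
    rw [← ENNReal.ofReal_add hε'0.le (by positivity)]
    refine ENNReal.ofReal_le_ofReal ?_
    have h1 : ‖κ‖ * B ≤ ε' * B := mul_le_mul_of_nonneg_right hκε hB0
    have h2 : ε' + ε' * B = ε := by rw [hε']; field_simp
    linarith

/-- Both functions vanish at 0, so their difference is the integral of D - Ψ'. Its L¹ norm is at
most its L^p norm because (0,1) has measure 1. -/
theorem abs_sub_le_eLpNorm {p : ℝ≥0∞} (hp : 1 ≤ p) {Φ D Ψ : ℝ → ℝ} {c ε : ℝ}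
    (h : IsProfile Φ D c) (hD : MemLp D p (volume.restrict (Ioo 0 1))) (h0 : Φ 0 = 0)
    (hΨ : ContDiff ℝ ((⊤ : ℕ∞) : WithTop ℕ∞) Ψ) (hΨ0 : Ψ 0 = 0) (hε : 0 ≤ ε)
    (hle : eLpNorm (D - deriv Ψ) p (volume.restrict (Ioo 0 1)) ≤ ENNReal.ofReal ε)
    {s : ℝ} (hs : s ∈ Ioo (0 : ℝ) 1) : |Φ s - Ψ s| ≤ ε := by
  have hΨ' : Continuous (deriv Ψ) := hΨ.continuous_deriv (by simp)
  have hint : IntegrableOn (fun t ↦ D t - deriv Ψ t) (Ioo 0 1) :=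
    (hD.integrable hp).sub ((hΨ'.integrableOn_Icc (a := 0) (b := 1)).mono_set Ioo_subset_Icc_self)
  have hint' : IntegrableOn (fun t ↦ D t - deriv Ψ t) (Ioc 0 s) :=
    hint.mono_set fun t ht ↦ ⟨ht.1, ht.2.trans_lt hs.2⟩
  have hftc := integral_eq_of_hasDerivAt_off_countable_of_le (fun t ↦ Φ t - Ψ t)
    (fun t ↦ D t - deriv Ψ t) hs.1.le (countable_singleton c)
    (h.cont.sub hΨ.continuous).continuousOn
    (fun t ht ↦ (h.hasDerivAt t ⟨ht.1.1, ht.1.2.trans hs.2⟩ ht.2).sub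
      ((hΨ.differentiable (by simp)) t).hasDerivAt)
    ((intervalIntegrable_iff_integrableOn_Ioc_of_le hs.1.le).2 hint')
  simp only [h0, hΨ0, sub_zero] at hftc
  rw [← hftc, ← Real.norm_eq_abs, ← ENNReal.ofReal_le_ofReal_iff hε, ofReal_norm,
    intervalIntegral.integral_of_le hs.1.le]
  refine (enorm_integral_le_lintegral_enorm _).trans ?_
  refine (lintegral_mono_set (t := Ioo 0 1) fun t ht ↦ ⟨ht.1, ht.2.trans_lt hs.2⟩).trans ?_
  rw [← eLpNorm_one_eq_lintegral_enorm]
  exact (eLpNorm_le_eLpNorm_of_exponent_le hp hint.aestronglyMeasurable).trans hle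

/-- Smooth profiles supported away from the endpoints give test functions on the annulus. -/
theorem isTestFunction_radial {n : ℕ} {Ψ : ℝ → ℝ}
    (hΨ : ContDiff ℝ ((⊤ : ℕ∞) : WithTop ℕ∞) Ψ) {δ : ℝ} (hδ : 0 < δ)
    (h0 : ∀ s, s ∉ Icc δ (1 - δ) → Ψ s = 0) :
    IsTestFunction (annulusA n) (fun x ↦ Ψ (logRadius x)) := by
  set T : Set (RSpace n) := {x | Real.exp (δ - 1) ≤ ‖x‖ ∧ ‖x‖ ≤ Real.exp (-δ)} with hT
  have hTc : IsClosed T :=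
    (isClosed_le continuous_const continuous_norm).inter
      (isClosed_le continuous_norm continuous_const)
  have hTA : T ⊆ annulusA n := by
    rintro x ⟨h1, h2⟩
    refine ⟨lt_of_lt_of_le ?_ h1, h2.trans_lt ?_⟩
    · rw [← Real.exp_neg]
      exact Real.exp_lt_exp.2 (by linarith)
    · exact Real.exp_lt_one_iff.2 (by linarith)
  have hTcomp : IsCompact T := by
    refine (isCompact_closedBall (0 : RSpace n) 1).of_isClosed_subset hTc fun x hx ↦ ?_
    simpa using (hTA hx).2.le
  have hsub : ∀ x : RSpace n, x ∉ T → Ψ (logRadius x) = 0 := by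
    intro x hx
    refine h0 _ fun hs ↦ hx ?_
    -- With `Real.log 0 = 0` the origin has `logRadius` equal to 1, which lies outside [δ, 1-δ].
    have hx0 : 0 < ‖x‖ := by
      by_contra h
      have : ‖x‖ = 0 := le_antisymm (not_lt.1 h) (norm_nonneg x)
      simp only [logRadius, this, Real.log_zero] at hs
      linarith [hs.2]
    rw [logRadius] at hs
    exact ⟨(Real.le_log_iff_exp_le hx0).1 (by linarith [hs.1]),
      (Real.log_le_iff_le_exp hx0).1 (by linarith [hs.2])⟩
  refine ⟨contDiff_iff_contDiffAt.2 fun x ↦ ?_, HasCompactSupport.intro hTcomp hsub,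
    (closure_minimal (fun x hx ↦ ?_) hTc).trans hTA⟩
  · by_cases hx : x = 0
    · refine (contDiffAt_const (c := (0 : ℝ))).congr_of_eventuallyEq ?_
      have hxT : x ∉ T := by
        rintro ⟨h1, -⟩
        rw [hx, norm_zero] at h1
        linarith [Real.exp_pos (δ - 1)]
      filter_upwards [hTc.isOpen_compl.mem_nhds hxT] with z hz
      exact hsub z hz
    · refine hΨ.contDiffAt.comp x ?_
      exact contDiffAt_const.add ((contDiffAt_norm ℝ hx).log (norm_ne_zero_iff.2 hx))
  · by_contra h
    exact hx (hsub x h)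

theorem memLp_radial {n : ℕ} {Φ D : ℝ → ℝ} {c : ℝ} (h : IsProfile Φ D c) (p : ℝ≥0∞) :
    MemLp (fun x ↦ Φ (logRadius x)) p (volume.restrict (annulusA n)) := by
  have : IsFiniteMeasure (volume.restrict (annulusA n)) :=
    ⟨by simpa using volume_annulusA_lt_top n⟩
  obtain ⟨C, hC⟩ := isCompact_Icc.exists_bound_of_continuousOn
    (h.cont.continuousOn (s := Icc (0 : ℝ) 1))
  refine MemLp.of_bound (h.cont.measurable.comp measurable_logRadius).aestronglyMeasurable C ?_
  filter_upwards [ae_restrict_mem (isOpen_annulusA n).measurableSet] with x hx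
  exact hC _ (Ioo_subset_Icc_self (logRadius_mem hx))

theorem memLp_radialGrad {n : ℕ} (hn : n ≠ 0) {D : ℝ → ℝ} (hDm : Measurable D)
    (hD : MemLp D (ENNReal.ofReal n) (volume.restrict (Ioo 0 1))) :
    MemLp (radialGrad D) (ENNReal.ofReal n) (volume.restrict (annulusA n)) := by
  refine ⟨(measurable_radialGrad hDm).aestronglyMeasurable, ?_⟩
  rw [eLpNorm_radialGrad hn hDm]
  exact ENNReal.mul_lt_top (ENNReal.rpow_lt_top_of_nonneg (by positivity) ENNReal.ofReal_ne_top)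
    hD.eLpNorm_lt_top

/-- Radial functions whose profile vanishes at both endpoints have zero boundary values. -/
theorem memW1pZero_radial {n : ℕ} (hn : 2 ≤ n) {Φ D : ℝ → ℝ} {c : ℝ} (h : IsProfile Φ D c)
    (hD : MemLp D (ENNReal.ofReal n) (volume.restrict (Ioo 0 1))) (h0 : Φ 0 = 0) (h1 : Φ 1 = 0) :
    MemW1pZero (annulusA n) n (fun x ↦ Φ (logRadius x)) := by
  have hn0 : n ≠ 0 := by omega
  have hp : 1 ≤ ENNReal.ofReal (n : ℝ) := by
    rw [ENNReal.one_le_ofReal]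
    exact_mod_cast (by omega : 1 ≤ n)
  have hg := memLp_radialGrad hn0 h.meas hD
  have hDint : IntegrableOn D (Ioo 0 1) := hD.integrable hp
  -- The two boundary values enter here: equal end values mean that D has mean zero, as the
  -- approximation by derivatives requires.
  have hmean : ∫ s in Ioo 0 1, D s = 0 := by
    rw [restrict_Ioo_eq_restrict_Ioc, ← intervalIntegral.integral_of_le zero_le_one,
      integral_eq_of_hasDerivAt_off_countable_of_le Φ D zero_le_one (countable_singleton c)
      h.cont.continuousOn (fun s hs ↦ h.hasDerivAt s hs.1 hs.2)
      ((intervalIntegrable_iff_integrableOn_Ioo_of_le zero_le_one).2 hDint), h0, h1, sub_zero]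
  have happ : ∀ k : ℕ, ∃ Ψ : ℝ → ℝ, ContDiff ℝ ((⊤ : ℕ∞) : WithTop ℕ∞) Ψ ∧
      (∃ δ : ℝ, 0 < δ ∧ δ < 1 / 2 ∧ ∀ s, s ∉ Icc δ (1 - δ) → Ψ s = 0) ∧
      eLpNorm (D - deriv Ψ) (ENNReal.ofReal n) (volume.restrict (Ioo 0 1)) ≤
        ENNReal.ofReal (1 / ((k : ℝ) + 1)) := fun k ↦
    exists_contDiff_eLpNorm_sub_deriv_le hp ENNReal.ofReal_ne_top hD hmean (by positivity)
  choose Ψ hΨ hΨs hΨD using happ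
  choose δ hδ0 hδ1 hδ using hΨs
  have hlim : Tendsto (fun k : ℕ ↦ ENNReal.ofReal (1 / ((k : ℝ) + 1))) atTop (𝓝 0) := by
    simpa using ENNReal.tendsto_ofReal tendsto_one_div_add_atTop_nhds_zero_nat
  have hsq : ∀ {C : ℝ≥0∞} {F : ℕ → ℝ≥0∞}, C ≠ ∞ →
      (∀ k, F k ≤ C * ENNReal.ofReal (1 / ((k : ℝ) + 1))) → Tendsto F atTop (𝓝 0) := by
    intro C F hC hF
    refine tendsto_of_tendsto_of_tendsto_of_le_of_le tendsto_const_nhds ?_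
      (fun _ ↦ zero_le) hF
    simpa using ENNReal.Tendsto.const_mul hlim (Or.inr hC)
  refine ⟨memLp_radial h _, radialGrad D, hasWeakGradient_radial hn h hg, hg,
    fun k x ↦ Ψ k (logRadius x), fun k ↦ isTestFunction_radial (hΨ k) (hδ0 k) (hδ k), ?_, ?_⟩
  · refine hsq (C := volume.restrict (annulusA n) univ ^ (ENNReal.ofReal (n : ℝ)).toReal⁻¹) ?_
      fun k ↦ eLpNorm_le_of_ae_bound ?_
    · refine ENNReal.rpow_ne_top_of_nonneg (by positivity) ?_
      simpa using (volume_annulusA_lt_top n).ne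
    · filter_upwards [ae_restrict_mem (isOpen_annulusA n).measurableSet] with x hx
      exact abs_sub_le_eLpNorm hp h hD h0 (hΨ k)
        (hδ k 0 fun h ↦ (hδ0 k).not_ge h.1) (by positivity) (hΨD k) (logRadius_mem hx)
  · refine hsq (C := ENNReal.ofReal (sphereArea n) ^ (1 / (n : ℝ)))
      (ENNReal.rpow_ne_top_of_nonneg (by positivity) ENNReal.ofReal_ne_top) fun k ↦ ?_
    have hm : Measurable (D - deriv (Ψ k)) := h.meas.sub (measurable_deriv _)
    refine le_trans (le_of_eq ?_) (mul_le_mul_right (hΨD k) _)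
    rw [← eLpNorm_radialGrad hn0 hm]
    refine eLpNorm_congr_ae ?_
    filter_upwards [ae_restrict_mem (isOpen_annulusA n).measurableSet] with x hx
    rw [(hasGradientAt_comp_logRadius (norm_pos_iff.1 (mem_annulusA_pos hx))
      (((hΨ k).differentiable (by simp)) _).hasDerivAt).gradient, radialGrad, radialGrad,
      ← sub_smul, ← sub_div, Pi.sub_apply]

/-! ### Transfer to the annulus and conclusion. -/

theorem log_exp_one_mul {r : ℝ} (hr : 0 < r) : Real.log (Real.exp 1 * r) = 1 + Real.log r := by
  rw [Real.log_mul (Real.exp_ne_zero _) hr.ne', Real.log_exp]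

theorem isCrossing_iff {a b r : ℝ} (hr : 0 < r) :
    IsCrossing a b r ↔ IsCrossingOne a b (1 + Real.log r) := by
  have h1 : (Real.exp 1)⁻¹ < r ↔ 0 < 1 + Real.log r := by
    rw [← Real.exp_neg, ← Real.lt_log_iff_exp_lt hr, neg_lt_iff_pos_add']
  have h2 : r < 1 ↔ 1 + Real.log r < 1 := by
    rw [add_lt_iff_neg_left, Real.log_neg_iff hr]
  rw [IsCrossing, IsCrossingOne, mem_Ioo, mem_Ioo, h1, h2, logPow₁, logPow₂, log_exp_one_mul hr,
    show 1 - (1 + Real.log r) = -Real.log r by ring]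
  refine and_congr_right fun _ ↦ ⟨fun h ↦ by linarith, fun h ↦ by linarith⟩

theorem IsCrossing.pos {a b r : ℝ} (h : IsCrossing a b r) : 0 < r :=
  (inv_pos.2 (Real.exp_pos 1)).trans h.1.1

theorem existsUnique_isCrossing {a b : ℝ} (ha : 1 < a) (hb : 0 < b) (hb1 : b < 1) :
    ∃! r, IsCrossing a b r := by
  obtain ⟨x, hx, hux⟩ := existsUnique_isCrossingOne ha hb hb1
  refine ⟨Real.exp (x - 1), (isCrossing_iff (Real.exp_pos _)).2 (by simpa using hx),
    fun r hr ↦ ?_⟩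
  rw [← hux _ ((isCrossing_iff hr.pos).1 hr), add_sub_cancel_left, Real.exp_log hr.pos]

theorem minLogPow_eq {n : ℕ} {x : RSpace n} (hx : x ≠ 0) (a b : ℝ) :
    minLogPow n a b x = minPow a b (logRadius x) := by
  rw [minLogPow, minPow, logPow₁, logPow₂, log_exp_one_mul (norm_pos_iff.2 hx), logRadius,
    show 1 - (1 + Real.log ‖x‖) = -Real.log ‖x‖ by ring]

theorem HasWeakGradient.congr {n : ℕ} {Ω : Set (RSpace n)} (hΩ : MeasurableSet Ω)
    {u v : RSpace n → ℝ} {g : RSpace n → RSpace n} (h : HasWeakGradient Ω u g) (huv : EqOn u v Ω) :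
    HasWeakGradient Ω v g := by
  refine ⟨fun x hx ↦ ?_, h.2.1, fun ψ hψ y ↦ ?_⟩
  · obtain ⟨t, ht, hi⟩ := h.1 x hx
    refine ⟨t ∩ Ω, inter_mem ht self_mem_nhdsWithin, ?_⟩
    refine (hi.mono_set inter_subset_left).congr ?_
    filter_upwards [ae_restrict_of_ae_restrict_of_subset inter_subset_right
      (ae_restrict_mem hΩ)] with y hy
    exact huv hy
  · rw [← h.2.2 ψ hψ y]
    refine setIntegral_congr_fun hΩ fun x hx ↦ ?_
    simp only [huv hx]

theorem minLogPow_eqOn (n : ℕ) (a b : ℝ) :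
    EqOn (fun x ↦ minPow a b (logRadius x)) (minLogPow n a b) (annulusA n) := fun _ hx ↦
  (minLogPow_eq (norm_pos_iff.1 (mem_annulusA_pos hx)) a b).symm

theorem isProfile_minPow {a b x : ℝ} (ha : 1 < a) (hb : 0 < b) (hb1 : b < 1)
    (hx : IsCrossingOne a b x) : IsProfile (minPow a b) (minPowDeriv a b x) x where
  cont := continuous_minPow (by linarith) hb
  meas := measurable_minPowDeriv a b x
  hasDerivAt _ hs hsx := hasDerivAt_minPow ha hb hb1 hx hs hsx
  bdd _ r hl hr := ⟨a + b * (1 - r) ^ (b - 1), fun _ hs ↦ abs_minPowDeriv_le ha hb hb1 hl hr hs⟩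

/-- This supplies the test function s - w(s), which lifts w to the linear profile s. -/
theorem IsProfile.id_sub {Φ D : ℝ → ℝ} {c : ℝ} (h : IsProfile Φ D c) :
    IsProfile (fun s ↦ s - Φ s) (fun s ↦ 1 - D s) c where
  cont := continuous_id.sub h.cont
  meas := measurable_const.sub h.meas
  hasDerivAt s hs hsc := (hasDerivAt_id s).sub (h.hasDerivAt s hs hsc)
  bdd l r hl hr := by
    obtain ⟨C, hC⟩ := h.bdd l r hl hr
    refine ⟨1 + C, fun s hs ↦ (abs_sub _ _).trans ?_⟩
    rw [abs_one]
    linarith [hC s hs]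

theorem IsLowerExponent.pos {n : ℕ} {Q b : ℝ} (hn : 2 ≤ n) (h : IsLowerExponent n Q b) :
    0 < b := by
  have hn0 : (2 : ℝ) ≤ n := by exact_mod_cast hn
  have : 1 / (n : ℝ) ≤ 1 := by rw [div_le_one (by linarith)]; linarith
  linarith [h.1]

theorem QHat_eq {n : ℕ} {Q₁ Q₂ a b r : ℝ} (hr : 0 < r) :
    QHat n Q₁ Q₂ a b r = Q₁ * (1 + Real.log r) ^ ((n : ℝ) * (a - 1) + 1) +
      Q₂ * (1 - (1 + Real.log r)) ^ ((n : ℝ) * (b - 1) + 1) := by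
  rw [QHat, log_exp_one_mul hr, show 1 - (1 + Real.log r) = -Real.log r by ring]

theorem memLp_minPowDeriv {n : ℕ} {Q₁ Q₂ a b x : ℝ} (hn : 2 ≤ n)
    (ha : IsUpperExponent n Q₁ a) (hb : IsLowerExponent n Q₂ b) (hx : x ∈ Ioo (0 : ℝ) 1) :
    MemLp (minPowDeriv a b x) (ENNReal.ofReal n) (volume.restrict (Ioo 0 1)) := by
  have h0 : ENNReal.ofReal (n : ℝ) ≠ 0 := by
    simp
    omega
  refine ⟨(measurable_minPowDeriv a b x).aestronglyMeasurable, ?_⟩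
  rw [eLpNorm_lt_top_iff_lintegral_rpow_enorm_lt_top h0 ENNReal.ofReal_ne_top,
    ENNReal.toReal_ofReal (Nat.cast_nonneg n), lintegral_minPowDeriv hn ha hb hx]
  exact ENNReal.ofReal_lt_top

theorem lintegral_deriv_minPow {a b x : ℝ} (ha : 1 < a) (hb : 0 < b) (hb1 : b < 1)
    (hx : IsCrossingOne a b x) (p : ℝ) :
    ∫⁻ s in Ioo (0 : ℝ) 1, ‖deriv (minPow a b) s‖ₑ ^ p =
      ∫⁻ s in Ioo (0 : ℝ) 1, ‖minPowDeriv a b x s‖ₑ ^ p := by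
  refine setLIntegral_congr_fun_ae measurableSet_Ioo ?_
  filter_upwards [compl_mem_ae_iff.2 (measure_singleton x)] with s hs hs'
  rw [(hasDerivAt_minPow ha hb hb1 hx hs' hs).deriv]

/-- Testing with φ = s - w(s) replaces u by log|ex|, whose profile has derivative 1 and whose energy
is c_{n-1}. Cancelling c_{n-1} > 0 leaves Q̂ ≤ Q. -/
theorem not_isQuasisuperminimizer_minLogPow {n : ℕ} (hn : 2 ≤ n) {Q₁ Q₂ a b x Q : ℝ}
    (ha : IsUpperExponent n Q₁ a) (hb : IsLowerExponent n Q₂ b) (hx : IsCrossingOne a b x)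
    (hQpos : 0 < Q₁ * x ^ ((n : ℝ) * (a - 1) + 1) + Q₂ * (1 - x) ^ ((n : ℝ) * (b - 1) + 1))
    (hQ : Q < Q₁ * x ^ ((n : ℝ) * (a - 1) + 1) + Q₂ * (1 - x) ^ ((n : ℝ) * (b - 1) + 1)) :
    ¬ IsQuasisuperminimizer (annulusA n) n Q (minLogPow n a b) := by
  rintro ⟨-, h⟩
  have hn0 : n ≠ 0 := by omega
  have hA := (isOpen_annulusA n).measurableSet
  have hb0 := hb.pos hn
  have hprof := isProfile_minPow ha.1 hb0 hb.2.1 hx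
  have hD := memLp_minPowDeriv hn ha hb hx.1
  have hD' : MemLp (fun s ↦ 1 - minPowDeriv a b x s) (ENNReal.ofReal n)
      (volume.restrict (Ioo 0 1)) := (memLp_const 1).sub hD
  have hu := (hasWeakGradient_radial hn hprof (memLp_radialGrad hn0 hprof.meas hD)).congr hA
    (minLogPow_eqOn n a b)
  have hφ := hasWeakGradient_radial hn hprof.id_sub (memLp_radialGrad hn0 hprof.id_sub.meas hD')
  have hφ0 := memW1pZero_radial hn hprof.id_sub hD'
    (by simp [minPow_zero (by linarith [ha.1] : a ≠ 0)]) (by simp [minPow_one hb0.ne'])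
  have hpos : ∀ y ∈ annulusA n, 0 < logRadius y - minPow a b (logRadius y) := fun y hy ↦
    sub_pos.2 (minPow_lt_self ha.1 (logRadius_mem hy))
  have key := h _ _ _ hu hφ0 hφ (by
    filter_upwards [ae_restrict_mem hA] with y hy
    exact (hpos y hy).le)
  have hset : annulusA n ∩ {y | logRadius y - minPow a b (logRadius y) ≠ 0} = annulusA n :=
    inter_eq_left.2 fun y hy ↦ (hpos y hy).ne'
  have hsum : (fun y : RSpace n ↦ radialGrad (minPowDeriv a b x) y +
      radialGrad (fun s ↦ 1 - minPowDeriv a b x s) y) = radialGrad fun _ ↦ 1 := by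
    ext1 y
    rw [radialGrad, radialGrad, radialGrad, ← add_smul, ← add_div, add_sub_cancel]
  rw [hset, hsum, pEnergy_radialGrad hn0 hprof.meas, pEnergy_radialGrad hn0 measurable_const,
    lintegral_minPowDeriv hn ha hb hx.1, mul_left_comm] at key
  have hc : ENNReal.ofReal (sphereArea n) ≠ 0 :=
    (ENNReal.ofReal_pos.2 (sphereArea_pos hn0)).ne'
  rw [ENNReal.mul_le_mul_iff_right hc ENNReal.ofReal_ne_top] at key
  simp only [enorm_one, ENNReal.one_rpow, lintegral_one, measure_univ, mul_one] at key
  -- `ENNReal.ofReal` sends negative Q to 0; positivity of Q̂ keeps the inequality strict in that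
  -- case too.
  exact absurd key (not_le.2 ((ENNReal.ofReal_lt_ofReal_iff hQpos).2 hQ))

theorem mainTheorem3 (n : ℕ) (hn : 2 ≤ n) (Q₁ Q₂ : ℝ) (hQ₁ : 1 < Q₁) (hQ₂ : 1 < Q₂) :
    (∃! α₁ : ℝ, IsUpperExponent n Q₁ α₁) ∧ (∃! α₂ : ℝ, IsLowerExponent n Q₂ α₂) ∧
    ∀ α₁ α₂ : ℝ, IsUpperExponent n Q₁ α₁ → IsLowerExponent n Q₂ α₂ →
      (∃! r₀ : ℝ, IsCrossing α₁ α₂ r₀) ∧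
      ∀ r₀ : ℝ, IsCrossing α₁ α₂ r₀ →
        -- the minimum lies in the Sobolev space, and its energy is `c_{n-1} Q̂`
        (MemW1p (annulusA n) n (minLogPow n α₁ α₂) ∧
          ∀ g : RSpace n → RSpace n, HasWeakGradient (annulusA n) (minLogPow n α₁ α₂) g →
            pEnergy (annulusA n) n g =
              ENNReal.ofReal (sphereArea n * QHat n Q₁ Q₂ α₁ α₂ r₀)) ∧
        -- the minimum is not a `Q`-quasisuperminimizer for any `Q < Q̂`
        (∀ Q : ℝ, Q < QHat n Q₁ Q₂ α₁ α₂ r₀ →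
          ¬ IsQuasisuperminimizer (annulusA n) n Q (minLogPow n α₁ α₂)) ∧
        -- `Q̂` is the one-dimensional constant `Q̃`, the energy of the one-dimensional example
        (∃! x₀ : ℝ, IsCrossingOne α₁ α₂ x₀) ∧
        (∀ c : ℝ, IsQTilde n Q₁ Q₂ c ↔ c = QHat n Q₁ Q₂ α₁ α₂ r₀) ∧
        ∫⁻ x in Ioo (0 : ℝ) 1, ‖deriv (minPow α₁ α₂) x‖ₑ ^ (n : ℝ) =
          ENNReal.ofReal (QHat n Q₁ Q₂ α₁ α₂ r₀) := by
  have hn0 : n ≠ 0 := by omega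
  have hn2 : (2 : ℝ) ≤ n := by exact_mod_cast hn
  have hA := (isOpen_annulusA n).measurableSet
  have hup := existsUnique_isUpperExponent hn2 hQ₁
  have hlow := existsUnique_isLowerExponent hn2 hQ₂
  refine ⟨hup, hlow, fun a b ha hb ↦ ?_⟩
  have hb0 := hb.pos hn
  refine ⟨existsUnique_isCrossing ha.1 hb0 hb.2.1, fun r hr ↦ ?_⟩
  have hx := (isCrossing_iff hr.pos).1 hr
  rw [QHat_eq hr.pos]
  set x : ℝ := 1 + Real.log r
  have hQpos : 0 < Q₁ * x ^ ((n : ℝ) * (a - 1) + 1) + Q₂ * (1 - x) ^ ((n : ℝ) * (b - 1) + 1) :=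
    add_pos (mul_pos (by linarith) (Real.rpow_pos_of_pos hx.1.1 _))
      (mul_pos (by linarith) (Real.rpow_pos_of_pos (sub_pos.2 hx.1.2) _))
  have hprof := isProfile_minPow ha.1 hb0 hb.2.1 hx
  have hD := memLp_minPowDeriv hn ha hb hx.1
  have hu := (hasWeakGradient_radial hn hprof (memLp_radialGrad hn0 hprof.meas hD)).congr hA
    (minLogPow_eqOn n a b)
  refine ⟨⟨⟨(memLp_radial hprof _).ae_eq ?_, _, hu, memLp_radialGrad hn0 hprof.meas hD⟩,
    fun g hg ↦ ?_⟩, fun Q hQ ↦ not_isQuasisuperminimizer_minLogPow hn ha hb hx hQpos hQ,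
    existsUnique_isCrossingOne ha.1 hb0 hb.2.1, fun c ↦ ⟨?_, ?_⟩, ?_⟩
  · filter_upwards [ae_restrict_mem hA] with y hy
    exact minLogPow_eqOn n a b hy
  · rw [hg.pEnergy_eq (isOpen_annulusA n) hu, pEnergy_radialGrad hn0 hprof.meas,
      lintegral_minPowDeriv hn ha hb hx.1, ENNReal.ofReal_mul (sphereArea_pos hn0).le]
  -- `IsQTilde` carries its own exponents and crossing point; uniqueness identifies them with the
  -- given ones.
  · rintro ⟨a', b', y, ha', hb', hy, rfl⟩
    obtain rfl := hup.unique ha ha'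
    obtain rfl := hlow.unique hb hb'
    rw [isCrossingOne_unique ha.1 hb0 hb.2.1 hx hy]
  · rintro rfl
    exact ⟨a, b, x, ha, hb, hx, rfl⟩
  · rw [lintegral_deriv_minPow ha.1 hb0 hb.2.1 hx, lintegral_minPowDeriv hn ha hb hx.1]
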